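/- Let $p\ge 1$ be a real number, and let $[0,\infty)$ carry the metric $d(x,y)=|x-y|$. Let $\mathbb{P}_p([0,\infty))$ be the set of Borel probability measures $\mu$ on $[0,\infty)$ with $\int x^p\,d\mu(x)<\infty$, equipped with the $p$-Wasserstein metric $$\mathrm{W}_p(\mu,\nu)=\inf_{\pi}\left(\int |x-y|^p\,d\pi(x,y)\right)^{1/p},$$ where $\pi$ runs over the probability measures on $[0,\infty)\times[0,\infty)$ with first marginal $\mu$ and second marginal $\nu$. An isometry of a metric space is a surjective distance-preserving self-map. Then every isometry of $\mathbb{P}_p([0,\infty))$ is the identity. Moreover, $[0,\infty)$ is isometrically rigid with respect to $\mathbb{P}_p$; that is, the push-forward map $\varphi\mapsto\varphi_\#$ is a group isomorphism from the isometry group of $[0,\infty)$ onto the isometry group of $\mathbb{P}_p([0,\infty))$. -/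

import Mathlib

open MeasureTheory
open scoped ENNReal NNReal

section Wasserstein

variable {X : Type*} [MetricSpace X] [MeasurableSpace X]

/-- The transport plans (couplings) between `μ` and `ν`: the probability measures on `X × X`
with first marginal `μ` and second marginal `ν`. -/
def transportPlans (μ ν : Measure X) : Set (Measure (X × X)) :=
  {π | IsProbabilityMeasure π ∧ π.map Prod.fst = μ ∧ π.map Prod.snd = ν}

/-- The Wasserstein distance of order `p`: the infimum of `(∫ d(x, y) ^ p dπ) ^ (1 / p)` over the
transport plans `π`. It has values in `[0, ∞]`, and is finite on the Wasserstein space when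
`1 ≤ p`. -/
noncomputable def wassersteinDist (p : ℝ) (μ ν : Measure X) : ℝ≥0∞ :=
  ⨅ π ∈ transportPlans μ ν, (∫⁻ z, edist z.1 z.2 ^ p ∂π) ^ (1 / p)

variable (X) in
/-- The Wasserstein space of order `p`: probability measures on `X` with finite `p`-moment. -/
def WassersteinSpace (p : ℝ) : Type _ :=
  {μ : Measure X // IsProbabilityMeasure μ ∧ ∃ x₀ : X, ∫⁻ x, edist x x₀ ^ p ∂μ < ∞}

variable (X) in
/-- The group of isometries of the Wasserstein space, under composition: the bijections preserving
the Wasserstein distance. -/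
def wassersteinIsom (p : ℝ) : Subgroup (Equiv.Perm (WassersteinSpace X p)) where
  carrier := {Φ | ∀ μ ν, wassersteinDist p (Φ μ).1 (Φ ν).1 = wassersteinDist p μ.1 ν.1}
  mul_mem' := by
    intro Φ Ψ hΦ hΨ μ ν
    exact (hΦ (Ψ μ) (Ψ ν)).trans (hΨ μ ν)
  one_mem' := fun _ _ => rfl
  inv_mem' := by
    intro Φ hΦ μ ν
    have h := hΦ (Φ⁻¹ μ) (Φ⁻¹ ν)
    simpa using h.symm

variable [BorelSpace X]

/-- The push-forward of measures by an isometry of `X`, on the Wasserstein space. -/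
noncomputable def wassersteinMap (p : ℝ) (φ : X ≃ᵢ X) (μ : WassersteinSpace X p) :
    WassersteinSpace X p :=
  ⟨μ.1.map φ, by
    obtain ⟨μ, hμ, x₀, hx₀⟩ := μ
    refine ⟨Measure.isProbabilityMeasure_map φ.continuous.measurable.aemeasurable, φ x₀, ?_⟩
    have h := lintegral_map_equiv (μ := μ) (fun x => edist x (φ x₀) ^ p)
      φ.toHomeomorph.toMeasurableEquiv
    simp only [Homeomorph.toMeasurableEquiv_coe, IsometryEquiv.coe_toHomeomorph,
      IsometryEquiv.edist_eq] at h
    rw [h]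
    exact hx₀⟩

theorem wassersteinMap_mul (p : ℝ) (φ ψ : X ≃ᵢ X) (μ : WassersteinSpace X p) :
    wassersteinMap p (φ * ψ) μ = wassersteinMap p φ (wassersteinMap p ψ μ) :=
  Subtype.ext (Measure.map_map φ.continuous.measurable ψ.continuous.measurable).symm

theorem wassersteinMap_one (p : ℝ) (μ : WassersteinSpace X p) :
    wassersteinMap p (1 : X ≃ᵢ X) μ = μ :=
  Subtype.ext Measure.map_id

theorem wassersteinDist_map_le (p : ℝ) (φ : X ≃ᵢ X) (μ ν : Measure X) :
    wassersteinDist p (μ.map φ) (ν.map φ) ≤ wassersteinDist p μ ν := by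
  refine le_iInf₂ fun π hπ => ?_
  obtain ⟨h1, h2, h3⟩ := hπ
  have hφ : Measurable φ := φ.continuous.measurable
  let e : X × X ≃ᵐ X × X :=
    φ.toHomeomorph.toMeasurableEquiv.prodCongr φ.toHomeomorph.toMeasurableEquiv
  have hfst : Prod.fst ∘ e = φ ∘ Prod.fst := rfl
  have hsnd : Prod.snd ∘ e = φ ∘ Prod.snd := rfl
  have hmem : π.map e ∈ transportPlans (μ.map φ) (ν.map φ) := by
    refine ⟨Measure.isProbabilityMeasure_map e.measurable.aemeasurable, ?_, ?_⟩
    · rw [Measure.map_map measurable_fst e.measurable, hfst,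
        ← Measure.map_map hφ measurable_fst, h2]
    · rw [Measure.map_map measurable_snd e.measurable, hsnd,
        ← Measure.map_map hφ measurable_snd, h3]
  refine (iInf₂_le (π.map e) hmem).trans (le_of_eq ?_)
  rw [lintegral_map_equiv]
  congr 1
  refine lintegral_congr fun z => ?_
  change edist (φ z.1) (φ z.2) ^ p = _
  rw [φ.edist_eq]

theorem wassersteinDist_map (p : ℝ) (φ : X ≃ᵢ X) (μ ν : WassersteinSpace X p) :
    wassersteinDist p (wassersteinMap p φ μ).1 (wassersteinMap p φ ν).1
      = wassersteinDist p μ.1 ν.1 := by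
  refine le_antisymm (wassersteinDist_map_le p φ μ.1 ν.1) ?_
  have h := wassersteinDist_map_le p φ⁻¹ (wassersteinMap p φ μ).1 (wassersteinMap p φ ν).1
  change wassersteinDist p (wassersteinMap p φ⁻¹ (wassersteinMap p φ μ)).1
    (wassersteinMap p φ⁻¹ (wassersteinMap p φ ν)).1 ≤ _ at h
  rwa [← wassersteinMap_mul, ← wassersteinMap_mul, inv_mul_cancel, wassersteinMap_one,
    wassersteinMap_one] at h

variable (X) in
/-- The push-forward homomorphism `φ ↦ φ_#`, from the group of isometries of `X` to the group of
isometries of its Wasserstein space. -/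
noncomputable def pushforwardHom (p : ℝ) : (X ≃ᵢ X) →* wassersteinIsom X p where
  toFun φ :=
    ⟨{ toFun := wassersteinMap p φ
       invFun := wassersteinMap p φ⁻¹
       left_inv := fun μ => by
        rw [← wassersteinMap_mul, inv_mul_cancel, wassersteinMap_one]
       right_inv := fun μ => by
        rw [← wassersteinMap_mul, mul_inv_cancel, wassersteinMap_one] },
      wassersteinDist_map p φ⟩
  map_one' := Subtype.ext (Equiv.ext fun μ => wassersteinMap_one p μ)
  map_mul' φ ψ := Subtype.ext (Equiv.ext fun μ => wassersteinMap_mul p φ ψ μ)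

variable (X) in
/-- `X` is isometrically rigid with respect to the Wasserstein space of order `p`: push-forward is
a group isomorphism from the isometries of `X` to the isometries of the Wasserstein space. -/
def IsIsometricallyRigid (p : ℝ) : Prop :=
  Function.Bijective (pushforwardHom X p)

end Wasserstein

/-!
The quantile function identifies a probability measure on `[0, ∞)` with a nonnegative monotone
function on `(0, 1)`, and turns the `p`-Wasserstein distance into the distance of `L ^ p`
(`wassersteinDist_map_monotone`): the cost `(x - y)₊ ^ p` is the area of a region whose sections
are products of an upper set in `x` and a lower set in `y`, and the monotone coupling gives such
products the least possible mass. So the Wasserstein space is a convex cone in `L ^ p (0, 1)`, and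
an isometry is studied through metric properties of this cone.

The apex of the cone, the Dirac measure at `0`, is the only point that is not the metric midpoint of
two other points (`isApex_origin`, `eq_origin_of_isApex`), so an isometry fixes it and preserves the
`L ^ p` norm. Next, call a point extremal if every pair of which it is a metric midpoint is aligned
with it, as seen from the apex (`IsExtremal`); an isometry permutes the extremal points.

* For `p = 1` the extremal points are the Dirac measures. Their norms tell them apart, so they are
  fixed. The distances from a measure `μ` to them give `c ↦ ∫ min x c dμ`, whose slopes are the
  tails of `μ` (`eq_self_of_isometry_one`).
* For `1 < p` strict convexity shows that the extremal points are the measures with at most one atom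
  away from `0` and no other mass there, that is, the points on the extreme rays of the cone
  (`isExtremal_step`, `exists_step_of_isExtremal`). Those of a given norm are parametrized by
  `(0, 1]`, and their distance is a strictly monotone function of the ratio of the parameters, so
  they are fixed (`map_normStep`). The distances to them determine the quantile function almost
  everywhere (`eq_of_wdist_step_eq`).

Hence every isometry of the Wasserstein space is the identity. Applied to push-forwards of Dirac
measures this shows that every isometry of `[0, ∞)` is the identity, and both groups are trivial.
-/

namespace HalfLine

open Set Filter Topology

/-! ### The open unit interval as the source of quantile functions -/

/-- The open unit interval, with Lebesgue measure: the probability space on which the quantile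
functions live. The endpoints are left out so that quantile functions are finite everywhere. -/
abbrev OpenUnit : Type := Ioo (0 : ℝ) 1

noncomputable instance : MeasureSpace OpenUnit := Measure.Subtype.measureSpace

instance : IsProbabilityMeasure (volume : Measure OpenUnit) where
  measure_univ := by
    rw [← volume_image_subtype_coe measurableSet_Ioo, image_univ, Subtype.range_coe]
    simp

instance : Nonempty OpenUnit := ⟨⟨1 / 2, by norm_num, by norm_num⟩⟩

lemma volume_coe_preimage {s : Set ℝ} (hs : MeasurableSet s) :
    volume ((↑) ⁻¹' s : Set OpenUnit) = volume (s ∩ Ioo (0 : ℝ) 1) :=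
  volume_preimage_coe measurableSet_Ioo.nullMeasurableSet hs

lemma volume_coe_le {a : ℝ} (ha : a ≤ 1) :
    volume {t : OpenUnit | (t : ℝ) ≤ a} = ENNReal.ofReal a := by
  have h := volume_coe_preimage (measurableSet_Iic (a := a))
  have e : ((↑) ⁻¹' Iic a : Set OpenUnit) = {t : OpenUnit | (t : ℝ) ≤ a} := rfl
  rw [e] at h
  rw [h]
  refine le_antisymm ?_ ?_
  · refine (measure_mono (t := Ioc 0 a) fun x hx => ⟨hx.2.1, hx.1⟩).trans ?_
    simp
  · refine le_trans ?_ (measure_mono (s := Ioo 0 a) fun x hx =>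
      ⟨hx.2.le, hx.1, hx.2.trans_le ha⟩)
    simp

lemma volume_lt_coe {a : ℝ} (h0 : 0 ≤ a) (ha : a ≤ 1) :
    volume {t : OpenUnit | a < (t : ℝ)} = ENNReal.ofReal (1 - a) := by
  have e : {t : OpenUnit | a < (t : ℝ)} = {t : OpenUnit | (t : ℝ) ≤ a}ᶜ := by
    ext t; simp
  rw [e, measure_compl (measurableSet_le (by fun_prop) (by fun_prop)) (measure_ne_top _ _),
    volume_coe_le ha, measure_univ, ENNReal.ofReal_sub _ h0, ENNReal.ofReal_one]

lemma volume_Ioc_pos {s t : OpenUnit} (h : s < t) : 0 < volume (Ioc s t) := by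
  have h1 := volume_coe_preimage (measurableSet_Ioc (a := (s : ℝ)) (b := t))
  have e : ((↑) ⁻¹' Ioc (s : ℝ) t : Set OpenUnit) = Ioc s t := rfl
  rw [e] at h1
  have hsub : Ioc (s : ℝ) t ⊆ Ioo 0 1 := fun x hx => ⟨s.2.1.trans hx.1, hx.2.trans_lt t.2.2⟩
  rw [h1, inter_eq_left.2 hsub]
  simpa using h

lemma volume_Iic_pos (t : OpenUnit) : 0 < volume (Iic t) := by
  have e : Iic t = {s : OpenUnit | (s : ℝ) ≤ t} := rfl
  rw [e, volume_coe_le t.2.2.le]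
  simpa using t.2.1

lemma volume_Ioi_pos (t : OpenUnit) : 0 < volume (Ioi t) := by
  have e : Ioi t = {s : OpenUnit | (t : ℝ) < s} := rfl
  rw [e, volume_lt_coe t.2.1.le t.2.2.le]
  simpa using t.2.2

/-! ### Quantile functions -/

/-- The quantile function of a measure on `[0, ∞)`, restricted to the open unit interval. -/
noncomputable def quantile (μ : Measure ℝ≥0) (t : OpenUnit) : ℝ≥0 :=
  sInf {x : ℝ≥0 | ENNReal.ofReal t ≤ μ (Iic x)}

lemma quantile_set_nonempty (μ : Measure ℝ≥0) [IsProbabilityMeasure μ] (t : OpenUnit) :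
    {x : ℝ≥0 | ENNReal.ofReal t ≤ μ (Iic x)}.Nonempty := by
  have h := tendsto_measure_Iic_atTop μ
  rw [measure_univ] at h
  have ht : ENNReal.ofReal t < 1 := by
    rw [← ENNReal.ofReal_one]; exact (ENNReal.ofReal_lt_ofReal_iff one_pos).2 t.2.2
  obtain ⟨x, hx⟩ := (h.eventually_const_lt ht).exists
  exact ⟨x, hx.le⟩

lemma quantile_monotone (μ : Measure ℝ≥0) [IsProbabilityMeasure μ] : Monotone (quantile μ) := by
  intro s t hst
  refine csInf_le_csInf (OrderBot.bddBelow _) (quantile_set_nonempty μ t) fun x hx => ?_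
  exact (ENNReal.ofReal_le_ofReal hst).trans hx

lemma quantile_le_iff (μ : Measure ℝ≥0) [IsProbabilityMeasure μ] (t : OpenUnit) (x : ℝ≥0) :
    quantile μ t ≤ x ↔ ENNReal.ofReal t ≤ μ (Iic x) := by
  refine ⟨fun h => ?_, fun h => csInf_le (OrderBot.bddBelow _) h⟩
  have hlim : Tendsto (fun y : ℝ≥0 => μ (Iic y)) (𝓝[>] x) (𝓝 (μ (Iic x))) := by
    have := tendsto_measure_biInter_gt (μ := μ) (s := fun y : ℝ≥0 => Iic y) (a := x)
      (fun r _ => measurableSet_Iic.nullMeasurableSet) (fun i j _ hij => Iic_subset_Iic.2 hij)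
      ⟨x + 1, by simp, measure_ne_top _ _⟩
    have e : (⋂ r > x, Iic r) = Iic x := by
      ext z
      simp only [mem_iInter, mem_Iic, gt_iff_lt]
      exact ⟨fun h => le_of_forall_gt_imp_ge_of_dense h, fun h r hr => h.trans hr.le⟩
    rwa [e] at this
  refine ge_of_tendsto hlim (eventually_nhdsWithin_of_forall fun y hy => ?_)
  obtain ⟨z, hz, hzy⟩ := exists_lt_of_csInf_lt (quantile_set_nonempty μ t) (h.trans_lt hy)
  exact hz.trans (measure_mono (Iic_subset_Iic.2 hzy.le))

lemma map_quantile (μ : Measure ℝ≥0) [IsProbabilityMeasure μ] :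
    (volume : Measure OpenUnit).map (quantile μ) = μ := by
  have : IsProbabilityMeasure ((volume : Measure OpenUnit).map (quantile μ)) :=
    Measure.isProbabilityMeasure_map (quantile_monotone μ).measurable.aemeasurable
  refine Measure.ext_of_Iic _ _ fun x => ?_
  rw [Measure.map_apply (quantile_monotone μ).measurable measurableSet_Iic]
  have e : quantile μ ⁻¹' Iic x = {t : OpenUnit | (t : ℝ) ≤ (μ (Iic x)).toReal} := by
    ext t
    simp only [mem_preimage, mem_Iic, quantile_le_iff, mem_ofPred_eq]
    exact ENNReal.ofReal_le_iff_le_toReal (measure_ne_top _ _)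
  rw [e, volume_coe_le, ENNReal.ofReal_toReal (measure_ne_top _ _)]
  exact ENNReal.toReal_le_of_le_ofReal zero_le_one (by simpa using prob_le_one)

/-! ### Optimality of the monotone coupling -/

/-- Among all couplings of the laws of two monotone functions `F` and `G`, the monotone one gives
the least mass to sets of the form (complement of a lower set) × (lower set). -/
lemma volume_comonotone_le {F G : OpenUnit → ℝ≥0} (hF : Monotone F) (hG : Monotone G)
    {π : Measure (ℝ≥0 × ℝ≥0)} [IsFiniteMeasure π]
    (h1 : π.map Prod.fst = volume.map F) (h2 : π.map Prod.snd = volume.map G)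
    {A B : Set ℝ≥0} (hA : IsLowerSet A) (hB : IsLowerSet B)
    (hAm : MeasurableSet A) (hBm : MeasurableSet B) :
    volume (G ⁻¹' A \ F ⁻¹' B) ≤ π (Prod.snd ⁻¹' A \ Prod.fst ⁻¹' B) := by
  have hI : IsLowerSet (G ⁻¹' A) := fun _ _ h ha => hA (hG h) ha
  have hJ : IsLowerSet (F ⁻¹' B) := fun _ _ h hb => hB (hF h) hb
  rcases hI.total hJ with h | h
  · rw [sdiff_eq_empty.2 h]; simp
  · rw [measure_sdiff h (hF.measurable hBm).nullMeasurableSet (measure_ne_top _ _),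
      ← Measure.map_apply hG.measurable hAm, ← Measure.map_apply hF.measurable hBm, ← h1, ← h2,
      Measure.map_apply measurable_snd hAm, Measure.map_apply measurable_fst hBm]
    exact le_measure_sdiff

/-- The weight in the layer-cake formula for `(x - y)₊ ^ p`: the derivative of `(u - y)₊ ^ p`
in `u`. The case distinction matters for `p = 1`, where `0 ^ (p - 1) = 1`. -/
noncomputable def layerWeight (p : ℝ) (u : ℝ) (y : ℝ≥0) : ℝ :=
  if (y : ℝ) < u then p * (u - y) ^ (p - 1) else 0

/-- The region whose slices at `(x, y)` have area `(x - y)₊ ^ p`. -/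
def layerRegion (p : ℝ) : Set ((ℝ≥0 × ℝ≥0) × (ℝ × ℝ)) :=
  {w | 0 < w.2.2 ∧ w.2.1 < w.1.1 ∧ w.2.2 < layerWeight p w.2.1 w.1.2}

lemma measurableSet_layerRegion (p : ℝ) : MeasurableSet (layerRegion p) := by
  have h : Measurable fun w : (ℝ≥0 × ℝ≥0) × (ℝ × ℝ) => layerWeight p w.2.1 w.1.2 := by
    unfold layerWeight
    refine Measurable.ite (measurableSet_lt (by fun_prop) (by fun_prop)) (by fun_prop)
      measurable_const
  have h1 : Measurable fun w : (ℝ≥0 × ℝ≥0) × (ℝ × ℝ) => w.2.1 := by fun_prop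
  have h2 : Measurable fun w : (ℝ≥0 × ℝ≥0) × (ℝ × ℝ) => w.2.2 := by fun_prop
  have h3 : Measurable fun w : (ℝ≥0 × ℝ≥0) × (ℝ × ℝ) => (w.1.1 : ℝ) := by fun_prop
  exact (measurableSet_lt measurable_const h2).inter
    ((measurableSet_lt h1 h3).inter (measurableSet_lt h2 h))

lemma volume_slice_layerRegion {p : ℝ} (hp : 1 ≤ p) (z : ℝ≥0 × ℝ≥0) :
    volume (Prod.mk z ⁻¹' layerRegion p) = ((z.1 - z.2 : ℝ≥0) : ℝ≥0∞) ^ p := by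
  obtain ⟨x, y⟩ := z
  have hp0 : 0 < p := by linarith
  have e : Prod.mk (x, y) ⁻¹' layerRegion p =
      regionBetween (fun _ => 0) (fun u => p * (u - y) ^ (p - 1)) (Ioo (y : ℝ) x) := by
    ext ⟨u, r⟩
    simp only [layerRegion, layerWeight, mem_preimage, mem_ofPred_eq, regionBetween, mem_Ioo]
    constructor
    · rintro ⟨h1, h2, h3⟩
      split_ifs at h3 with h
      · exact ⟨⟨h, h2⟩, h1, h3⟩
      · exact absurd h3 (by linarith [h1])
    · rintro ⟨⟨h, h2⟩, h1, h3⟩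
      rw [if_pos h]
      exact ⟨h1, h2, h3⟩
  rw [e, Measure.volume_eq_prod, volume_regionBetween_eq_lintegral (by fun_prop) (by fun_prop)
    measurableSet_Ioo]
  simp only [Pi.sub_apply, sub_zero]
  rcases le_total x y with hxy | hxy
  · rw [Ioo_eq_empty (by simpa using hxy)]
    simp [tsub_eq_zero_of_le hxy, hp0]
  have hint : ∫ u in (y : ℝ)..x, p * (u - y) ^ (p - 1) = (x - y : ℝ) ^ p := by
    rw [intervalIntegral.integral_const_mul,
      intervalIntegral.integral_comp_sub_right (fun u => u ^ (p - 1)) (y : ℝ),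
      integral_rpow (Or.inl (by linarith))]
    simp [Real.zero_rpow hp0.ne']
    field_simp
  have hii : IntervalIntegrable (fun u : ℝ => p * (u - y) ^ (p - 1)) volume y x := by
    refine IntervalIntegrable.const_mul ?_ p
    have := (intervalIntegral.intervalIntegrable_rpow' (a := 0) (b := x - y) (r := p - 1)
      (by linarith)).comp_sub_right (y : ℝ)
    simpa using this
  rw [setLIntegral_congr Ioo_ae_eq_Ioc, ← ofReal_integral_eq_lintegral_ofReal
      ((intervalIntegrable_iff_integrableOn_Ioc_of_le (by exact_mod_cast hxy)).1 hii),
    ← intervalIntegral.integral_of_le (by exact_mod_cast hxy), hint,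
    ← ENNReal.ofReal_rpow_of_nonneg (by simpa using hxy) hp0.le,
    ← NNReal.coe_sub hxy, ENNReal.ofReal_coe_nnreal]
  refine (ae_restrict_iff' measurableSet_Ioc).2 (Eventually.of_forall fun u hu => ?_)
  exact mul_nonneg hp0.le (Real.rpow_nonneg (by linarith [hu.1]) _)

/-- One-sided optimality of the monotone coupling: both sides are integrals, over the layers
`(u, r)`, of the masses compared in `volume_comonotone_le`. -/
lemma lintegral_tsub_rpow_comonotone_le {p : ℝ} (hp : 1 ≤ p) {F G : OpenUnit → ℝ≥0}
    (hF : Monotone F) (hG : Monotone G) {π : Measure (ℝ≥0 × ℝ≥0)} [IsFiniteMeasure π]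
    (h1 : π.map Prod.fst = volume.map F) (h2 : π.map Prod.snd = volume.map G) :
    ∫⁻ t, ((F t - G t : ℝ≥0) : ℝ≥0∞) ^ p ≤ ∫⁻ z, ((z.1 - z.2 : ℝ≥0) : ℝ≥0∞) ^ p ∂π := by
  have hFG : Measurable fun t => (F t, G t) := hF.measurable.prodMk hG.measurable
  have hcost : Measurable fun z : ℝ≥0 × ℝ≥0 => ((z.1 - z.2 : ℝ≥0) : ℝ≥0∞) ^ p := by fun_prop
  have e : ∫⁻ t, ((F t - G t : ℝ≥0) : ℝ≥0∞) ^ p =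
      ∫⁻ z, ((z.1 - z.2 : ℝ≥0) : ℝ≥0∞) ^ p ∂(volume.map fun t => (F t, G t)) :=
    (lintegral_map hcost hFG).symm
  rw [e]
  simp_rw [← volume_slice_layerRegion hp]
  have hS := measurableSet_layerRegion p
  rw [← Measure.prod_apply hS, ← Measure.prod_apply hS, Measure.prod_apply_symm hS,
    Measure.prod_apply_symm hS]
  refine lintegral_mono fun q => ?_
  obtain ⟨u, r⟩ := q
  have hm : MeasurableSet ((fun z : ℝ≥0 × ℝ≥0 => (z, (u, r))) ⁻¹' layerRegion p) :=
    measurable_prodMk_right hS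
  rcases le_or_gt r 0 with hr | hr
  · have : (fun z : ℝ≥0 × ℝ≥0 => (z, (u, r))) ⁻¹' layerRegion p = ∅ := by
      ext z; simp [layerRegion, hr.not_gt]
    simp [this]
  have hA : IsLowerSet {y : ℝ≥0 | r < layerWeight p u y} := by
    intro y y' hy h
    have hy' : (y' : ℝ) ≤ y := by exact_mod_cast hy
    simp only [mem_ofPred_eq, layerWeight] at h ⊢
    split_ifs at h with h'
    · rw [if_pos (hy'.trans_lt h')]
      refine h.trans_le (mul_le_mul_of_nonneg_left ?_ (by linarith))
      exact Real.rpow_le_rpow (by linarith) (by linarith) (by linarith)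
    · exact absurd h hr.not_gt
  have hB : IsLowerSet {x : ℝ≥0 | (x : ℝ) ≤ u} := fun x x' hx h =>
    le_trans (NNReal.coe_le_coe.2 hx) h
  have hAm : MeasurableSet {y : ℝ≥0 | r < layerWeight p u y} := by
    refine measurableSet_lt measurable_const ?_
    unfold layerWeight
    exact Measurable.ite (measurableSet_lt (by fun_prop) (by fun_prop)) (by fun_prop)
      measurable_const
  have hBm : MeasurableSet {x : ℝ≥0 | (x : ℝ) ≤ u} := measurableSet_le (by fun_prop) (by fun_prop)
  have es : (fun z : ℝ≥0 × ℝ≥0 => (z, (u, r))) ⁻¹' layerRegion p =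
      Prod.snd ⁻¹' {y : ℝ≥0 | r < layerWeight p u y} \ Prod.fst ⁻¹' {x : ℝ≥0 | (x : ℝ) ≤ u} := by
    ext z
    simp only [layerRegion, mem_preimage, mem_ofPred_eq, Set.mem_sdiff, not_le, hr, true_and]
    exact and_comm
  have h := volume_comonotone_le hF hG h1 h2 hA hB hAm hBm
  rw [Measure.map_apply hFG hm, es]
  exact h

lemma edist_rpow_eq_add {p : ℝ} (hp : 0 < p) (x y : ℝ≥0) :
    edist x y ^ p = ((x - y : ℝ≥0) : ℝ≥0∞) ^ p + ((y - x : ℝ≥0) : ℝ≥0∞) ^ p := by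
  rcases le_total x y with h | h
  · rw [edist_nndist, NNReal.nndist_eq, max_eq_right (by simp [tsub_eq_zero_of_le h]),
      tsub_eq_zero_of_le h]
    simp [hp]
  · rw [edist_nndist, NNReal.nndist_eq, max_eq_left (by simp [tsub_eq_zero_of_le h]),
      tsub_eq_zero_of_le h]
    simp [hp]

/-- The Wasserstein distance between the laws of two monotone functions is their distance in
`L ^ p`. -/
theorem wassersteinDist_map_monotone {p : ℝ} (hp : 1 ≤ p) {F G : OpenUnit → ℝ≥0}
    (hF : Monotone F) (hG : Monotone G) :
    wassersteinDist p (volume.map F) (volume.map G) = (∫⁻ t, edist (F t) (G t) ^ p) ^ (1 / p) := by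
  have hp0 : 0 < p := by linarith
  have hFG : Measurable fun t => (F t, G t) := hF.measurable.prodMk hG.measurable
  have hcost : Measurable fun z : ℝ≥0 × ℝ≥0 => edist z.1 z.2 ^ p := by fun_prop
  refine le_antisymm ?_ (le_iInf₂ fun π hπ => ?_)
  · refine (iInf₂_le (volume.map fun t => (F t, G t))
      ⟨Measure.isProbabilityMeasure_map hFG.aemeasurable, ?_, ?_⟩).trans (le_of_eq ?_)
    · rw [lintegral_map hcost hFG]
    · rw [Measure.map_map measurable_fst hFG]; rfl
    · rw [Measure.map_map measurable_snd hFG]; rfl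
  · obtain ⟨hπ0, h1, h2⟩ := hπ
    refine ENNReal.rpow_le_rpow ?_ (by positivity)
    have hswap1 : (π.map Prod.swap).map Prod.fst = volume.map G := by
      rw [Measure.map_map measurable_fst measurable_swap, ← h2]; rfl
    have hswap2 : (π.map Prod.swap).map Prod.snd = volume.map F := by
      rw [Measure.map_map measurable_snd measurable_swap, ← h1]; rfl
    have hb := lintegral_tsub_rpow_comonotone_le hp hG hF hswap1 hswap2
    rw [lintegral_map (by fun_prop) measurable_swap] at hb
    simp_rw [edist_rpow_eq_add hp0]
    have hFm := hF.measurable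
    have hGm := hG.measurable
    rw [lintegral_add_left (by fun_prop), lintegral_add_left (by fun_prop)]
    exact add_le_add (lintegral_tsub_rpow_comonotone_le hp hF hG h1 h2) hb

/-! ### The cone of quantile functions -/

lemma edist_zero_rpow (p : ℝ) (x : ℝ≥0) : edist x 0 ^ p = (x : ℝ≥0∞) ^ p := by
  rw [edist_nndist, NNReal.nndist_eq]; simp

lemma edist_rpow_le_add {p : ℝ} (hp : 0 < p) (x y : ℝ≥0) :
    edist x y ^ p ≤ (x : ℝ≥0∞) ^ p + (y : ℝ≥0∞) ^ p := by
  rw [edist_rpow_eq_add hp]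
  gcongr <;> exact tsub_le_self

lemma eq_zero_or_eq_zero_of_edist_rpow_eq {p : ℝ} (hp : 0 < p) {x y : ℝ≥0}
    (h : edist x y ^ p = (x : ℝ≥0∞) ^ p + (y : ℝ≥0∞) ^ p) : x = 0 ∨ y = 0 := by
  by_contra! hne
  obtain ⟨hx, hy⟩ := hne
  rw [edist_rpow_eq_add hp] at h
  refine h.not_lt (ENNReal.add_lt_add ?_ ?_)
  · exact ENNReal.rpow_lt_rpow (by exact_mod_cast tsub_lt_self hx.bot_lt hy.bot_lt) hp
  · exact ENNReal.rpow_lt_rpow (by exact_mod_cast tsub_lt_self hy.bot_lt hx.bot_lt) hp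

/-- The nonnegative monotone functions on `(0, 1)` with finite `L ^ p` norm. They are not required
to be left-continuous, so that a measure is the law of several of them, which agree almost
everywhere. -/
structure QuantileFun (p : ℝ) where
  /-- The underlying function. -/
  toFun : OpenUnit → ℝ≥0
  monotone : Monotone toFun
  lintegral_lt_top : ∫⁻ t, (toFun t : ℝ≥0∞) ^ p < ∞

namespace QuantileFun

variable {p : ℝ}

instance : CoeFun (QuantileFun p) fun _ => OpenUnit → ℝ≥0 := ⟨toFun⟩

@[fun_prop]
lemma measurable (f : QuantileFun p) : Measurable f := f.monotone.measurable

/-- The law of a quantile function, as a point of the Wasserstein space. -/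
noncomputable def law (f : QuantileFun p) : WassersteinSpace ℝ≥0 p :=
  ⟨(volume : Measure OpenUnit).map f,
    Measure.isProbabilityMeasure_map f.measurable.aemeasurable, 0, by
      rw [lintegral_map (by fun_prop) f.measurable]
      simp_rw [edist_zero_rpow]
      exact f.lintegral_lt_top⟩

lemma law_congr {f g : QuantileFun p} (h : ∀ᵐ t, f t = g t) : f.law = g.law :=
  Subtype.ext (Measure.map_congr h)

end QuantileFun

lemma exists_law_eq {p : ℝ} (hp : 1 ≤ p) (μ : WassersteinSpace ℝ≥0 p) :
    ∃ f : QuantileFun p, f.law = μ := by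
  obtain ⟨μ, hμ, x₀, hx₀⟩ := μ
  refine ⟨⟨quantile μ, quantile_monotone μ, ?_⟩, Subtype.ext (map_quantile μ)⟩
  have e : ∫⁻ t, (quantile μ t : ℝ≥0∞) ^ p = ∫⁻ x, (x : ℝ≥0∞) ^ p ∂μ := by
    conv_rhs => rw [← map_quantile μ]
    rw [lintegral_map (by fun_prop) (quantile_monotone μ).measurable]
  rw [e]
  calc ∫⁻ x, (x : ℝ≥0∞) ^ p ∂μ
      ≤ ∫⁻ x, (2 : ℝ≥0∞) ^ (p - 1) * (edist x x₀ ^ p + (x₀ : ℝ≥0∞) ^ p) ∂μ := by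
        refine lintegral_mono fun x => ?_
        refine le_trans ?_ (ENNReal.rpow_add_le_mul_rpow_add_rpow _ _ hp)
        refine ENNReal.rpow_le_rpow ?_ (by linarith)
        have := edist_triangle x x₀ 0
        rw [← ENNReal.rpow_one (edist x 0), edist_zero_rpow, ← ENNReal.rpow_one (edist x₀ 0),
          edist_zero_rpow] at this
        simpa using this
    _ = (2 : ℝ≥0∞) ^ (p - 1) * (∫⁻ x, edist x x₀ ^ p ∂μ + (x₀ : ℝ≥0∞) ^ p) := by
        rw [lintegral_const_mul _ (by fun_prop), lintegral_add_right _ measurable_const]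
        simp
    _ < ∞ := by
        refine ENNReal.mul_lt_top (ENNReal.rpow_lt_top_of_nonneg (by linarith) (by simp)) ?_
        exact ENNReal.add_lt_top.2
          ⟨hx₀, ENNReal.rpow_lt_top_of_nonneg (by linarith) (by simp)⟩

/-- The Wasserstein distance of two points of the Wasserstein space. -/
noncomputable abbrev wdist {p : ℝ} (μ ν : WassersteinSpace ℝ≥0 p) : ℝ≥0∞ :=
  wassersteinDist p μ.1 ν.1

/-- The `p`-th power of the distance of two functions in `L ^ p`. -/
noncomputable def cost (p : ℝ) (f g : OpenUnit → ℝ≥0) : ℝ≥0∞ := ∫⁻ t, edist (f t) (g t) ^ p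

lemma cost_comm (p : ℝ) (f g : OpenUnit → ℝ≥0) : cost p f g = cost p g f := by
  simp only [cost, edist_comm]

lemma cost_zero (p : ℝ) (f : OpenUnit → ℝ≥0) :
    cost p f (fun _ => 0) = ∫⁻ t, (f t : ℝ≥0∞) ^ p := by
  simp only [cost, edist_zero_rpow]

section

variable {p : ℝ}

lemma wdist_law (hp : 1 ≤ p) (f g : QuantileFun p) : wdist f.law g.law = cost p f g ^ (1 / p) :=
  wassersteinDist_map_monotone hp f.monotone g.monotone

lemma wdist_law_rpow (hp : 1 ≤ p) (f g : QuantileFun p) : wdist f.law g.law ^ p = cost p f g := by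
  rw [wdist_law hp, ← ENNReal.rpow_mul, one_div_mul_cancel (by linarith), ENNReal.rpow_one]

lemma wdist_eq_iff (hp : 1 ≤ p) (f g f' g' : QuantileFun p) :
    wdist f.law g.law = wdist f'.law g'.law ↔ cost p f g = cost p f' g' := by
  rw [← wdist_law_rpow hp, ← wdist_law_rpow hp]
  exact (ENNReal.rpow_left_injective (by linarith : p ≠ 0)).eq_iff.symm

lemma cost_ne_top (hp : 1 ≤ p) (f g : QuantileFun p) : cost p f g ≠ ∞ := by
  refine ne_top_of_le_ne_top (b := ∫⁻ t, ((f t : ℝ≥0∞) ^ p + (g t : ℝ≥0∞) ^ p)) ?_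
    (lintegral_mono fun t => edist_rpow_le_add (by linarith) _ _)
  rw [lintegral_add_left (by fun_prop)]
  exact (ENNReal.add_lt_top.2 ⟨f.lintegral_lt_top, g.lintegral_lt_top⟩).ne

lemma wdist_ne_top (hp : 1 ≤ p) (f g : QuantileFun p) : wdist f.law g.law ≠ ∞ := by
  rw [wdist_law hp]
  exact ENNReal.rpow_ne_top_of_nonneg (by positivity) (cost_ne_top hp f g)

lemma cost_eq_zero_iff (hp : 1 ≤ p) (f g : QuantileFun p) :
    cost p f g = 0 ↔ ∀ᵐ t, f t = g t := by
  rw [cost, lintegral_eq_zero_iff (by fun_prop)]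
  refine eventually_congr (Eventually.of_forall fun t => ?_)
  simp [ENNReal.rpow_eq_zero_iff, show 0 < p by linarith]

lemma eq_of_wdist_eq_zero (hp : 1 ≤ p) {μ ν : WassersteinSpace ℝ≥0 p} (h : wdist μ ν = 0) :
    μ = ν := by
  obtain ⟨f, rfl⟩ := exists_law_eq hp μ
  obtain ⟨g, rfl⟩ := exists_law_eq hp ν
  refine QuantileFun.law_congr ((cost_eq_zero_iff hp f g).1 ?_)
  rw [← wdist_law_rpow hp, h, ENNReal.zero_rpow_of_pos (by linarith)]

lemma wdist_self (hp : 1 ≤ p) (μ : WassersteinSpace ℝ≥0 p) : wdist μ μ = 0 := by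
  obtain ⟨f, rfl⟩ := exists_law_eq hp μ
  rw [wdist_law hp, (cost_eq_zero_iff hp f f).2 (by simp),
    ENNReal.zero_rpow_of_pos (by positivity)]

lemma wdist_comm (hp : 1 ≤ p) (μ ν : WassersteinSpace ℝ≥0 p) : wdist μ ν = wdist ν μ := by
  obtain ⟨f, rfl⟩ := exists_law_eq hp μ
  obtain ⟨g, rfl⟩ := exists_law_eq hp ν
  rw [wdist_eq_iff hp, cost_comm]

lemma law_eq_law_iff (hp : 1 ≤ p) (f g : QuantileFun p) :
    f.law = g.law ↔ ∀ᵐ t, f t = g t := by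
  refine ⟨fun h => (cost_eq_zero_iff hp f g).1 ?_, QuantileFun.law_congr⟩
  rw [← wdist_law_rpow hp, h, wdist_self hp, ENNReal.zero_rpow_of_pos (by linarith)]

/-- A bounded monotone function, as a quantile function. -/
noncomputable def QuantileFun.ofBounded (hp : 1 ≤ p) (f : OpenUnit → ℝ≥0) (hf : Monotone f)
    (c : ℝ≥0) (hc : ∀ t, f t ≤ c) : QuantileFun p where
  toFun := f
  monotone := hf
  lintegral_lt_top := by
    refine (lintegral_mono (g := fun _ => (c : ℝ≥0∞) ^ p) fun t =>
      ENNReal.rpow_le_rpow (by exact_mod_cast hc t) (by linarith)).trans_lt ?_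
    simpa using ENNReal.rpow_lt_top_of_nonneg (by linarith) (by simp)

/-- The quantile function of the Dirac measure at `c`. -/
noncomputable def QuantileFun.const (hp : 1 ≤ p) (c : ℝ≥0) : QuantileFun p :=
  .ofBounded hp (fun _ => c) monotone_const c fun _ => le_rfl

/-- A monotone function dominated by a multiple of a quantile function, as a quantile function. -/
noncomputable def QuantileFun.ofLe (hp : 1 ≤ p) (f : QuantileFun p) (C : ℝ≥0)
    (g : OpenUnit → ℝ≥0) (hg : Monotone g) (hgf : ∀ t, g t ≤ C * f t) : QuantileFun p where
  toFun := g
  monotone := hg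
  lintegral_lt_top := by
    have hp0 : 0 ≤ p := by linarith
    refine (lintegral_mono (g := fun t => (C : ℝ≥0∞) ^ p * (f t : ℝ≥0∞) ^ p) fun t => ?_).trans_lt
      ?_
    · simp only [← ENNReal.mul_rpow_of_nonneg _ _ hp0]
      exact ENNReal.rpow_le_rpow (by exact_mod_cast hgf t) hp0
    · rw [lintegral_const_mul _ (by fun_prop)]
      exact ENNReal.mul_lt_top (ENNReal.rpow_lt_top_of_nonneg hp0 (by simp)) f.lintegral_lt_top

/-! ### The apex of the cone -/

/-- `m` is a metric midpoint of `a` and `b`. -/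
def IsMetricMidpoint (m a b : WassersteinSpace ℝ≥0 p) : Prop :=
  wdist m a = wdist m b ∧ wdist a b = 2 * wdist m a

lemma isMetricMidpoint_law_iff (hp : 1 ≤ p) (f g h : QuantileFun p) :
    IsMetricMidpoint f.law g.law h.law ↔
      cost p f g = cost p f h ∧ cost p g h = 2 ^ p * cost p f g := by
  rw [IsMetricMidpoint, wdist_eq_iff hp]
  refine and_congr_right fun _ => ?_
  rw [← (ENNReal.rpow_left_injective (by linarith : p ≠ 0)).eq_iff,
    ENNReal.mul_rpow_of_nonneg _ _ (by linarith), wdist_law_rpow hp, wdist_law_rpow hp]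

/-- `m` is not the metric midpoint of a nondegenerate pair. -/
def IsApex (m : WassersteinSpace ℝ≥0 p) : Prop :=
  ∀ a b, IsMetricMidpoint m a b → a = m

/-- The Dirac measure at the origin. -/
noncomputable def origin (hp : 1 ≤ p) : WassersteinSpace ℝ≥0 p := (QuantileFun.const hp 0).law

lemma wdist_origin_rpow (hp : 1 ≤ p) (f : QuantileFun p) :
    wdist f.law (origin hp) ^ p = ∫⁻ t, (f t : ℝ≥0∞) ^ p := by
  rw [origin, wdist_law_rpow hp, ← cost_zero]
  rfl

/-- Two nonnegative functions `g`, `h` satisfy `‖g - h‖ ^ p ≤ ‖g‖ ^ p + ‖h‖ ^ p`, so they can have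
`0` as a metric midpoint only if their supports are disjoint. Supports of monotone functions are
nested, so one of the functions vanishes. -/
lemma isApex_origin (hp : 1 ≤ p) : IsApex (origin hp) := by
  have hp0 : 0 < p := by linarith
  intro a b h
  obtain ⟨g, rfl⟩ := exists_law_eq hp a
  obtain ⟨k, rfl⟩ := exists_law_eq hp b
  rw [origin, isMetricMidpoint_law_iff hp, cost_comm, cost_comm p _ k] at h
  obtain ⟨h1, h2⟩ := h
  by_cases hg0 : cost p g (QuantileFun.const hp 0) = 0
  · exact (law_eq_law_iff hp _ _).2 ((cost_eq_zero_iff hp _ _).1 hg0)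
  exfalso
  have hk0 : cost p k (QuantileFun.const hp 0) ≠ 0 := by rwa [← h1]
  have hsum : ∫⁻ t, ((g t : ℝ≥0∞) ^ p + (k t : ℝ≥0∞) ^ p) ≤ cost p g k := by
    rw [lintegral_add_left (by fun_prop), ← cost_zero, ← cost_zero, h2]
    change cost p g (QuantileFun.const hp 0) + cost p k (QuantileFun.const hp 0) ≤ _
    rw [← h1, ← two_mul]
    gcongr
    exact ENNReal.le_rpow_self_of_one_le (by norm_num) hp
  have hae := ae_eq_of_ae_le_of_lintegral_le
    (Eventually.of_forall fun t => edist_rpow_le_add hp0 (g t) (k t)) (cost_ne_top hp g k)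
    (by fun_prop) hsum
  simp only [ne_eq, cost_eq_zero_iff hp] at hg0 hk0
  have hz : ∀ᵐ t, g t = 0 ∨ k t = 0 := hae.mono fun t ht =>
    eq_zero_or_eq_zero_of_edist_rpow_eq hp0 ht
  have hl1 : IsUpperSet {t | g t ≠ 0} := fun s t hst hs => ne_bot_of_le_ne_bot hs (g.monotone hst)
  have hl2 : IsUpperSet {t | k t ≠ 0} := fun s t hst hs => ne_bot_of_le_ne_bot hs (k.monotone hst)
  rcases hl1.total hl2 with hs | hs
  · refine hg0 (hz.mono fun t ht => ?_)
    by_contra hgt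
    exact ht.elim hgt (hs hgt)
  · refine hk0 (hz.mono fun t ht => ?_)
    by_contra hgt
    exact ht.elim (hs hgt) hgt

/-- Any `f` is the midpoint of `0` and `2 * f`. -/
lemma eq_origin_of_isApex (hp : 1 ≤ p) {m : WassersteinSpace ℝ≥0 p} (hm : IsApex m) :
    m = origin hp := by
  obtain ⟨f, rfl⟩ := exists_law_eq hp m
  refine (hm (origin hp) (QuantileFun.ofLe hp f 2 (fun t => 2 * f t)
    (fun s t h => mul_le_mul_right (f.monotone h) _) fun t => le_rfl).law ?_).symm
  have hd (x : ℝ≥0) : edist x (2 * x) = edist x 0 := by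
    rw [two_mul, edist_nndist, edist_nndist, NNReal.nndist_eq, NNReal.nndist_eq]
    simp
  have hd' (x : ℝ≥0) : edist 0 (2 * x) = 2 * edist x 0 := by
    rw [edist_nndist, edist_nndist, NNReal.nndist_eq, NNReal.nndist_eq]
    simp
  rw [origin, isMetricMidpoint_law_iff hp]
  refine ⟨lintegral_congr fun t => ?_, ?_⟩
  · change edist (f t) 0 ^ p = edist (f t) (2 * f t) ^ p
    rw [hd]
  · unfold cost
    rw [← lintegral_const_mul _ (by fun_prop)]
    refine lintegral_congr fun t => ?_
    change edist 0 (2 * f t) ^ p = 2 ^ p * edist (f t) 0 ^ p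
    rw [hd', ENNReal.mul_rpow_of_nonneg _ _ (by linarith)]

/-! ### Metric notions preserved by isometries -/

/-- `a` and `b` are aligned with the origin: they attain equality in the reverse triangle
inequality for distances from the origin. -/
def IsAligned (hp : 1 ≤ p) (a b : WassersteinSpace ℝ≥0 p) : Prop :=
  wdist a b + wdist a (origin hp) = wdist b (origin hp) ∨
    wdist a b + wdist b (origin hp) = wdist a (origin hp)

lemma IsAligned.symm {hp : 1 ≤ p} {a b : WassersteinSpace ℝ≥0 p}
    (h : IsAligned hp a b) : IsAligned hp b a := by
  rw [IsAligned, wdist_comm hp b a]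
  exact Or.symm h

/-- Whenever `m` is a metric midpoint of `a` and `b`, the points `m` and `a` are aligned with the
origin. This selects the Dirac measures for `p = 1`, and the measures with at most one atom away
from the origin, and no other mass there, for `1 < p`. -/
def IsExtremal (hp : 1 ≤ p) (m : WassersteinSpace ℝ≥0 p) : Prop :=
  ∀ a b, IsMetricMidpoint m a b → IsAligned hp a m

section Isometry

variable {Φ : WassersteinSpace ℝ≥0 p → WassersteinSpace ℝ≥0 p}

lemma map_origin (hp : 1 ≤ p) (hs : Function.Surjective Φ)
    (hΦ : ∀ μ ν, wdist (Φ μ) (Φ ν) = wdist μ ν) : Φ (origin hp) = origin hp := by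
  refine eq_origin_of_isApex hp fun a b h => ?_
  obtain ⟨a, rfl⟩ := hs a
  obtain ⟨b, rfl⟩ := hs b
  rw [IsMetricMidpoint, hΦ, hΦ, hΦ] at h
  rw [isApex_origin hp a b h]

lemma wdist_map_origin (hp : 1 ≤ p) (hs : Function.Surjective Φ)
    (hΦ : ∀ μ ν, wdist (Φ μ) (Φ ν) = wdist μ ν) (μ : WassersteinSpace ℝ≥0 p) :
    wdist (Φ μ) (origin hp) = wdist μ (origin hp) := by
  conv_lhs => rw [← map_origin hp hs hΦ]
  exact hΦ _ _

lemma isExtremal_map_iff (hp : 1 ≤ p) (hs : Function.Surjective Φ)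
    (hΦ : ∀ μ ν, wdist (Φ μ) (Φ ν) = wdist μ ν) (m : WassersteinSpace ℝ≥0 p) :
    IsExtremal hp (Φ m) ↔ IsExtremal hp m := by
  unfold IsExtremal
  rw [hs.forall]
  refine forall_congr' fun a => ?_
  rw [hs.forall]
  refine forall_congr' fun b => ?_
  rw [IsMetricMidpoint, IsAligned, hΦ, hΦ, hΦ, hΦ, wdist_map_origin hp hs hΦ,
    wdist_map_origin hp hs hΦ]
  rfl

end Isometry

end

/-! ### The case `p = 1` -/

lemma edist_add_tsub (x y : ℝ≥0) : edist x (x + y) = (y : ℝ≥0∞) := by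
  rw [edist_nndist, NNReal.nndist_eq, add_tsub_cancel_left, tsub_eq_zero_of_le le_self_add]; simp

/-- `|x - c| + x = c + 2 (x - c)₊`. -/
lemma edist_add_left_eq (x c : ℝ≥0) :
    edist x c + x = c + 2 * ((x - c : ℝ≥0) : ℝ≥0∞) := by
  rw [edist_nndist, NNReal.nndist_eq]
  norm_cast
  rcases le_total x c with h | h
  · rw [tsub_eq_zero_of_le h, max_eq_right (by simp), tsub_add_cancel_of_le h]; simp
  · rw [max_eq_left (by simp [tsub_eq_zero_of_le h])]
    conv_lhs => rw [← tsub_add_cancel_of_le h]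
    rw [add_tsub_cancel_right]; ring

/-- `|x - c| + c = x + 2 (c - x)₊`. -/
lemma edist_add_right_eq (x c : ℝ≥0) :
    edist x c + c = x + 2 * ((c - x : ℝ≥0) : ℝ≥0∞) := by
  rw [edist_comm, edist_add_left_eq]

/-- `|x - c| + 2 min x c = x + c`. -/
lemma edist_add_two_mul_min (x c : ℝ≥0) :
    edist x c + 2 * ((min x c : ℝ≥0) : ℝ≥0∞) = x + c := by
  rw [edist_nndist, NNReal.nndist_eq]
  norm_cast
  rcases le_total x c with h | h
  · rw [min_eq_left h, max_eq_right (by simp [tsub_eq_zero_of_le h]), two_mul, ← add_assoc,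
      tsub_add_cancel_of_le h, add_comm]
  · rw [min_eq_right h, max_eq_left (by simp [tsub_eq_zero_of_le h]), two_mul, ← add_assoc,
      tsub_add_cancel_of_le h]

lemma eq_zero_of_coe_eq_add_two_mul {x d : ℝ≥0} (h : (x : ℝ≥0∞) = x + 2 * (d : ℝ≥0∞)) :
    d = 0 := by
  have h' : x = x + 2 * d := by exact_mod_cast h
  simpa using h'

lemma wdist_law_one (f g : QuantileFun 1) : wdist f.law g.law = ∫⁻ t, edist (f t) (g t) := by
  rw [wdist_law le_rfl, cost]
  simp

lemma wdist_origin_one (f : QuantileFun 1) :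
    wdist f.law (origin le_rfl) = ∫⁻ t, (f t : ℝ≥0∞) := by
  have := wdist_origin_rpow le_rfl f
  simpa using this

lemma lintegral_ne_top_one (f : QuantileFun 1) : ∫⁻ t, (f t : ℝ≥0∞) ≠ ∞ := by
  have := f.lintegral_lt_top.ne
  simpa using this

lemma isMetricMidpoint_law_one_iff (f g h : QuantileFun 1) :
    IsMetricMidpoint f.law g.law h.law ↔
      ∫⁻ t, edist (f t) (g t) = ∫⁻ t, edist (f t) (h t) ∧
        ∫⁻ t, edist (g t) (h t) = 2 * ∫⁻ t, edist (f t) (g t) := by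
  rw [IsMetricMidpoint, wdist_law_one, wdist_law_one, wdist_law_one]

/-- In `L ^ 1`, aligned functions are comparable almost everywhere. -/
lemma ae_le_or_ae_le_of_isAligned {f g : QuantileFun 1} (h : IsAligned le_rfl f.law g.law) :
    (∀ᵐ t, f t ≤ g t) ∨ ∀ᵐ t, g t ≤ f t := by
  rw [IsAligned, wdist_law_one, wdist_origin_one, wdist_origin_one] at h
  rcases h with h | h
  · left
    rw [← lintegral_add_left (by fun_prop)] at h
    have hle (t : OpenUnit) : (g t : ℝ≥0∞) ≤ edist (f t) (g t) + f t := by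
      rw [edist_add_left_eq]; exact le_self_add
    have hae := ae_eq_of_ae_le_of_lintegral_le (Eventually.of_forall hle)
      (lintegral_ne_top_one g) (by fun_prop) h.le
    refine hae.mono fun t ht => ?_
    beta_reduce at ht
    rw [edist_add_left_eq] at ht
    exact tsub_eq_zero_iff_le.1 (eq_zero_of_coe_eq_add_two_mul ht)
  · right
    rw [← lintegral_add_left (by fun_prop)] at h
    have hle (t : OpenUnit) : (f t : ℝ≥0∞) ≤ edist (f t) (g t) + g t := by
      rw [edist_add_right_eq]; exact le_self_add
    have hae := ae_eq_of_ae_le_of_lintegral_le (Eventually.of_forall hle)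
      (lintegral_ne_top_one f) (by fun_prop) h.le
    refine hae.mono fun t ht => ?_
    beta_reduce at ht
    rw [edist_add_right_eq] at ht
    exact tsub_eq_zero_iff_le.1 (eq_zero_of_coe_eq_add_two_mul ht)

lemma isAligned_of_ae_le {f g : QuantileFun 1} (h : ∀ᵐ t, f t ≤ g t) :
    IsAligned le_rfl f.law g.law := by
  left
  rw [wdist_law_one, wdist_origin_one, wdist_origin_one, ← lintegral_add_left (by fun_prop)]
  refine lintegral_congr_ae (h.mono fun t ht => ?_)
  simp only
  rw [edist_add_left_eq, tsub_eq_zero_of_le ht]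
  simp

/-- If a constant `c` is an `L ^ 1` midpoint of two monotone functions `g` and `h`, then `c` lies
between `g` and `h` almost everywhere; if `g` crossed `c`, monotonicity of `h` would force
`h = c`. -/
lemma isExtremal_const_one (c : ℝ≥0) :
    IsExtremal le_rfl (QuantileFun.const (p := 1) le_rfl c).law := by
  intro a b hab
  obtain ⟨g, rfl⟩ := exists_law_eq le_rfl a
  obtain ⟨h, rfl⟩ := exists_law_eq le_rfl b
  rw [isMetricMidpoint_law_one_iff] at hab
  obtain ⟨h1, h2⟩ := hab
  change ∫⁻ t, edist c (g t) = ∫⁻ t, edist c (h t) at h1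
  change _ = 2 * ∫⁻ t, edist c (g t) at h2
  have hsum : ∫⁻ t, (edist (g t) c + edist c (h t)) ≤ ∫⁻ t, edist (g t) (h t) := by
    rw [lintegral_add_left (by fun_prop), h2, ← h1, two_mul]
    simp only [edist_comm, le_refl]
  have hfin : ∫⁻ t, edist (g t) (h t) ≠ ∞ := by
    rw [← wdist_law_one]; exact wdist_ne_top le_rfl g h
  have hae := ae_eq_of_ae_le_of_lintegral_le
    (Eventually.of_forall fun t => edist_triangle (g t) c (h t)) hfin (by fun_prop) hsum
  have hbetween : ∀ᵐ t, (g t ≤ c ∧ c ≤ h t) ∨ (c ≤ g t ∧ h t ≤ c) := by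
    refine hae.mono fun t ht => ?_
    have ht' : dist (g t) (h t) = dist (g t) c + dist c (h t) := by
      simp only [edist_nndist] at ht
      simp only [dist_nndist]
      exact_mod_cast ht
    simp only [NNReal.dist_eq] at ht'
    simp only [← NNReal.coe_le_coe]
    by_contra! hcon
    obtain ⟨hc1, hc2⟩ := hcon
    rcases le_total (g t : ℝ) c with hx | hx
    · have := hc1 hx
      rw [abs_of_nonpos (by linarith : (g t : ℝ) - c ≤ 0),
        abs_of_pos (by linarith : (0 : ℝ) < c - h t)] at ht'
      rcases abs_cases ((g t : ℝ) - h t) with ⟨e, -⟩ | ⟨e, -⟩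
      · linarith [hc2 (by linarith)]
      · linarith
    · have := hc2 hx
      rw [abs_of_nonneg (by linarith : 0 ≤ (g t : ℝ) - c),
        abs_of_neg (by linarith : (c : ℝ) - h t < 0)] at ht'
      rcases abs_cases ((g t : ℝ) - h t) with ⟨e, -⟩ | ⟨e, -⟩
      · linarith
      · linarith [hc1 (by linarith)]
  by_cases hg1 : ∀ᵐ t, g t ≤ c
  · exact isAligned_of_ae_le hg1
  by_cases hg2 : ∀ᵐ t, c ≤ g t
  · exact (isAligned_of_ae_le hg2).symm
  exfalso
  obtain ⟨t₀, ht₀, ht₀'⟩ := ((not_eventually.1 hg1).and_eventually hbetween).exists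
  obtain ⟨s₀, hs₀, hs₀'⟩ := ((not_eventually.1 hg2).and_eventually hbetween).exists
  rw [not_le] at ht₀ hs₀
  have ht : h t₀ ≤ c := (ht₀'.resolve_left fun h => h.1.not_gt ht₀).2
  have hs : c ≤ h s₀ := (hs₀'.resolve_right fun h => h.1.not_gt hs₀).2
  have hhc : ∀ᵐ t, edist c (h t) = 0 := by
    refine hbetween.mono fun x hx => ?_
    rw [edist_eq_zero]
    have hs' : s₀ ≤ x → c ≤ h x := fun hsx => hs.trans (h.monotone hsx)
    have ht' : x ≤ t₀ → h x ≤ c := fun hxt => (h.monotone hxt).trans ht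
    rcases lt_trichotomy (g x) c with hgx | hgx | hgx
    · exact le_antisymm (hx.resolve_right fun h => h.1.not_gt hgx).2
        (ht' (g.monotone.reflect_lt (hgx.trans ht₀)).le)
    · exact le_antisymm (hs' (g.monotone.reflect_lt (hs₀.trans_eq hgx.symm)).le)
        (ht' (g.monotone.reflect_lt (hgx.trans_lt ht₀)).le)
    · exact le_antisymm (hs' (g.monotone.reflect_lt (hs₀.trans hgx)).le)
        (hx.resolve_left fun h => h.1.not_gt hgx).2
  rw [lintegral_congr_ae hhc, lintegral_zero, lintegral_eq_zero_iff (by fun_prop)] at h1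
  exact hg1 (h1.mono fun t ht => (edist_eq_zero.1 ht).ge)

/-- A nonconstant `f` is the `L ^ 1` midpoint of a constant `k` which it crosses and a function
`f + σ (f - k)₊`. -/
lemma exists_const_of_isExtremal_one {m : WassersteinSpace ℝ≥0 1} (hm : IsExtremal le_rfl m) :
    ∃ c, m = (QuantileFun.const le_rfl c).law := by
  obtain ⟨f, rfl⟩ := exists_law_eq le_rfl m
  by_cases hf : ∃ s t, f s < f t
  swap
  · push Not at hf
    obtain ⟨t₀⟩ : Nonempty OpenUnit := inferInstance
    exact ⟨f t₀, QuantileFun.law_congr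
      (Eventually.of_forall fun t => le_antisymm (hf _ _) (hf _ _))⟩
  exfalso
  obtain ⟨s, t, hst⟩ := hf
  obtain ⟨k, hsk, hkt⟩ := exists_between hst
  -- `σ = S / B` puts `f` at the same distance `S` from `k` and from `f + σ (f - k)₊`
  set S : ℝ≥0∞ := ∫⁻ t, edist (f t) k with hS
  set B : ℝ≥0∞ := ∫⁻ t, ((f t - k : ℝ≥0) : ℝ≥0∞) with hB
  have hSfin : S ≠ ∞ := by
    have := wdist_ne_top le_rfl f (QuantileFun.const le_rfl k)
    rwa [wdist_law_one] at this
  have hBfin : B ≠ ∞ := ne_top_of_le_ne_top (lintegral_ne_top_one f)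
    (lintegral_mono fun t => ENNReal.coe_le_coe.2 tsub_le_self)
  have hB0 : B ≠ 0 := by
    rw [hB, Ne, lintegral_eq_zero_iff (by fun_prop)]
    intro h0
    refine (volume_Ioi_pos t).ne' (measure_mono_null (fun x hx => ?_) (ae_iff.1 h0))
    simp only [mem_ofPred_eq, Pi.zero_apply, ENNReal.coe_eq_zero, tsub_eq_zero_iff_le, not_le]
    exact hkt.trans_le (f.monotone (le_of_lt hx))
  set σ : ℝ≥0 := (S / B).toNNReal with hσ
  have hσB : (σ : ℝ≥0∞) * B = S := by
    rw [hσ, ENNReal.coe_toNNReal (ENNReal.div_ne_top hSfin hB0), ENNReal.div_mul_cancel hB0 hBfin]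
  let h : QuantileFun 1 := QuantileFun.ofLe le_rfl f (1 + σ) (fun t => f t + σ * (f t - k))
    (fun x y hxy => by
      have := f.monotone hxy
      dsimp only
      gcongr) (fun x => by
      rw [add_mul, one_mul]
      gcongr
      exact tsub_le_self)
  have hfh : ∫⁻ t, edist (f t) (h t) = S := by
    rw [← hσB, hB, ← lintegral_const_mul _ (by fun_prop)]
    refine lintegral_congr fun x => ?_
    change edist (f x) (f x + σ * (f x - k)) = _
    rw [edist_add_tsub]; simp
  have hkh : ∫⁻ t, edist k (h t) = 2 * S := by
    rw [two_mul]
    nth_rw 2 [← hfh]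
    rw [hS, ← lintegral_add_left (by fun_prop)]
    refine lintegral_congr fun x => ?_
    change edist k (f x + σ * (f x - k)) = edist (f x) k + edist (f x) (f x + σ * (f x - k))
    rw [edist_add_tsub, edist_comm (f x) k]
    rcases le_total (f x) k with hx | hx
    · simp [tsub_eq_zero_of_le hx]
    · obtain ⟨d, hd⟩ := exists_add_of_le hx
      rw [hd, add_tsub_cancel_left, add_assoc, edist_add_tsub, edist_add_tsub]
      simp
  have hal := hm (QuantileFun.const le_rfl k).law h.law
    ((isMetricMidpoint_law_one_iff _ _ _).2 ⟨hfh.symm, hkh⟩)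
  rcases ae_le_or_ae_le_of_isAligned hal with h | h
  · refine (volume_Iic_pos s).ne' (measure_mono_null (fun x hx => ?_) (ae_iff.1 h))
    exact not_le.2 ((f.monotone hx).trans_lt hsk)
  · refine (volume_Ioi_pos t).ne' (measure_mono_null (fun x hx => ?_) (ae_iff.1 h))
    exact not_le.2 (hkt.trans_le (f.monotone (le_of_lt hx)))

/-- The difference quotients of `c ↦ ∫ min x c dμ` lie between the values of the tail
`c ↦ μ [c, ∞)` at the endpoints. -/
lemma measure_Ici_le_of_lintegral_min_eq {μ ν : Measure ℝ≥0} [IsFiniteMeasure μ]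
    [IsFiniteMeasure ν]
    (h : ∀ c : ℝ≥0, ∫⁻ x, ((min x c : ℝ≥0) : ℝ≥0∞) ∂μ = ∫⁻ x, ((min x c : ℝ≥0) : ℝ≥0∞) ∂ν)
    {a b : ℝ≥0} (hab : a < b) : μ (Ici b) ≤ ν (Ioi a) := by
  have hd : ((b - a : ℝ≥0) : ℝ≥0∞) ≠ 0 :=
    ENNReal.coe_ne_zero.2 (tsub_pos_of_lt hab).ne'
  have hfin : ∫⁻ x, ((min x a : ℝ≥0) : ℝ≥0∞) ∂μ ≠ ∞ := by
    refine ne_top_of_le_ne_top (b := ∫⁻ x, (a : ℝ≥0∞) ∂μ) ?_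
      (lintegral_mono fun x => ENNReal.coe_le_coe.2 (min_le_right x a))
    rw [lintegral_const]
    exact ENNReal.mul_ne_top (by simp) (measure_ne_top _ _)
  have h1 : ∫⁻ x, ((min x a : ℝ≥0) : ℝ≥0∞) ∂μ + ((b - a : ℝ≥0) : ℝ≥0∞) * μ (Ici b) ≤
      ∫⁻ x, ((min x b : ℝ≥0) : ℝ≥0∞) ∂μ := by
    rw [← lintegral_indicator_const measurableSet_Ici, ← lintegral_add_left (by fun_prop)]
    refine lintegral_mono fun x => ?_
    by_cases hx : x ∈ Ici b
    · rw [indicator_of_mem hx, min_eq_right (mem_Ici.1 hx), min_eq_right (hab.le.trans hx)]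
      norm_cast
      rw [add_tsub_cancel_of_le hab.le]
    · rw [indicator_of_notMem hx, add_zero]
      exact ENNReal.coe_le_coe.2 (min_le_min_left _ hab.le)
  have h2 : ∫⁻ x, ((min x b : ℝ≥0) : ℝ≥0∞) ∂ν ≤
      ∫⁻ x, ((min x a : ℝ≥0) : ℝ≥0∞) ∂ν + ((b - a : ℝ≥0) : ℝ≥0∞) * ν (Ioi a) := by
    rw [← lintegral_indicator_const measurableSet_Ioi, ← lintegral_add_left (by fun_prop)]
    refine lintegral_mono fun x => ?_
    by_cases hx : x ∈ Ioi a
    · rw [indicator_of_mem hx, min_eq_right (mem_Ioi.1 hx).le]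
      rw [← ENNReal.coe_add, add_tsub_cancel_of_le hab.le]
      exact ENNReal.coe_le_coe.2 (min_le_right _ _)
    · rw [indicator_of_notMem hx, add_zero]
      rw [mem_Ioi, not_lt] at hx
      rw [min_eq_left hx]
      exact ENNReal.coe_le_coe.2 (min_le_left _ _)
  rw [← h, ← h] at h2
  have h3 := (ENNReal.add_le_add_iff_left hfin).1 (h1.trans h2)
  exact (ENNReal.mul_le_mul_iff_right hd (by simp)).1 h3

lemma eq_of_lintegral_min_eq {μ ν : Measure ℝ≥0} [IsProbabilityMeasure μ] [IsProbabilityMeasure ν]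
    (h : ∀ c : ℝ≥0, ∫⁻ x, ((min x c : ℝ≥0) : ℝ≥0∞) ∂μ = ∫⁻ x, ((min x c : ℝ≥0) : ℝ≥0∞) ∂ν) :
    μ = ν := by
  have key {μ ν : Measure ℝ≥0} [IsProbabilityMeasure μ] [IsProbabilityMeasure ν]
      (h : ∀ c : ℝ≥0, ∫⁻ x, ((min x c : ℝ≥0) : ℝ≥0∞) ∂μ = ∫⁻ x, ((min x c : ℝ≥0) : ℝ≥0∞) ∂ν)
      (a : ℝ≥0) : μ (Ioi a) ≤ ν (Ioi a) := by
    obtain ⟨u, hu, hua, hlim⟩ := exists_seq_strictAnti_tendsto a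
    have e : Ioi a = ⋃ n, Ici (u n) := by
      ext x
      simp only [mem_Ioi, mem_iUnion, mem_Ici]
      refine ⟨fun hx => ?_, fun ⟨n, hn⟩ => (hua n).trans_le hn⟩
      obtain ⟨n, hn⟩ := (hlim.eventually_lt_const hx).exists
      exact ⟨n, hn.le⟩
    have hmono : Monotone fun n => Ici (u n) := fun i j hij => Ici_subset_Ici.2 (hu.antitone hij)
    conv_lhs => rw [e, hmono.measure_iUnion]
    exact iSup_le fun n => measure_Ici_le_of_lintegral_min_eq h (hua n)
  refine Measure.ext_of_Iic _ _ fun a => ?_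
  have := le_antisymm (key h a) (key (fun c => (h c).symm) a)
  rw [← compl_Ioi, measure_compl measurableSet_Ioi (measure_ne_top _ _),
    measure_compl measurableSet_Ioi (measure_ne_top _ _), this, measure_univ, measure_univ]

lemma eq_of_wdist_const_one {μ ν : WassersteinSpace ℝ≥0 1}
    (h : ∀ c, wdist μ (QuantileFun.const le_rfl c).law = wdist ν (QuantileFun.const le_rfl c).law) :
    μ = ν := by
  obtain ⟨f, rfl⟩ := exists_law_eq le_rfl μ
  obtain ⟨g, rfl⟩ := exists_law_eq le_rfl ν
  simp only [wdist_law_one] at h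
  have h0 := h 0
  have e (f : QuantileFun 1) (c : ℝ≥0) : (∫⁻ t, edist (f t) c) +
      2 * ∫⁻ x, ((min x c : ℝ≥0) : ℝ≥0∞) ∂f.law.1 = (∫⁻ t, (f t : ℝ≥0∞)) + c := by
    change _ + 2 * ∫⁻ x, ((min x c : ℝ≥0) : ℝ≥0∞) ∂(volume.map f) = _
    rw [lintegral_map (by fun_prop) f.measurable, ← lintegral_const_mul _ (by fun_prop),
      ← lintegral_add_left (by fun_prop)]
    simp_rw [edist_add_two_mul_min]
    rw [lintegral_add_right _ measurable_const]
    simp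
  have hm : ∫⁻ t, (f t : ℝ≥0∞) = ∫⁻ t, (g t : ℝ≥0∞) := by
    rw [← wdist_origin_one, ← wdist_origin_one, origin, wdist_law_one, wdist_law_one]
    exact h0
  have := f.law.2.1
  have := g.law.2.1
  refine Subtype.ext (eq_of_lintegral_min_eq fun c => ?_)
  have hc : ∫⁻ t, edist (f t) c = ∫⁻ t, edist (g t) c := h c
  have hfin : ∫⁻ t, edist (f t) c ≠ ∞ := by
    have := wdist_ne_top le_rfl f (QuantileFun.const le_rfl c)
    rwa [wdist_law_one] at this
  have h1 := e f c
  rw [hm, ← e g c, ← hc] at h1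
  have h2 := (ENNReal.add_right_inj hfin).1 h1
  exact (ENNReal.mul_right_inj two_ne_zero (by simp)).1 h2

/-- For `p = 1` the Dirac measures are fixed, since they are the extremal points, and they
determine every other point by its distances to them. -/
theorem eq_self_of_isometry_one {Φ : WassersteinSpace ℝ≥0 1 → WassersteinSpace ℝ≥0 1}
    (hs : Function.Surjective Φ) (hΦ : ∀ μ ν, wdist (Φ μ) (Φ ν) = wdist μ ν)
    (μ : WassersteinSpace ℝ≥0 1) : Φ μ = μ := by
  have hconst (c : ℝ≥0) :
      Φ (QuantileFun.const le_rfl c).law = (QuantileFun.const le_rfl c).law := by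
    obtain ⟨c', hc'⟩ := exists_const_of_isExtremal_one
      ((isExtremal_map_iff le_rfl hs hΦ _).2 (isExtremal_const_one c))
    have hn := wdist_map_origin le_rfl hs hΦ (QuantileFun.const le_rfl c).law
    rw [hc', wdist_origin_one, wdist_origin_one] at hn
    have : (c' : ℝ≥0∞) = c := by simpa [QuantileFun.const, QuantileFun.ofBounded] using hn
    rw [hc', ENNReal.coe_inj.1 this]
  refine eq_of_wdist_const_one fun c => ?_
  conv_lhs => rw [← hconst c]
  exact hΦ _ _

/-! ### Strict convexity for `1 < p` -/

lemma strictConvexOn_nnreal_rpow {p : ℝ} (hp : 1 < p) :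
    StrictConvexOn ℝ≥0 univ fun x : ℝ≥0 => x ^ p := by
  refine ⟨convex_univ, fun x _ y _ hxy a b ha hb hab => ?_⟩
  have h := (strictConvexOn_rpow hp).2 (mem_Ici.2 x.2) (mem_Ici.2 y.2)
    (fun h => hxy (NNReal.eq h)) (NNReal.coe_pos.2 ha) (NNReal.coe_pos.2 hb)
    (by rw [← NNReal.coe_add, hab, NNReal.coe_one])
  exact NNReal.coe_lt_coe.1 (by simpa using h)

lemma add_rpow_le_weighted {p : ℝ} (hp : 1 < p) {l m : ℝ≥0} (hl : 0 < l) (hm : 0 < m)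
    (hlm : l + m = 1) (x y : ℝ≥0) : (x + y) ^ p ≤ l * (x / l) ^ p + m * (y / m) ^ p := by
  have h := (strictConvexOn_nnreal_rpow hp).convexOn.2 (mem_univ (x / l)) (mem_univ (y / m))
    hl.le hm.le hlm
  simpa only [smul_eq_mul, mul_div_cancel₀ _ hl.ne', mul_div_cancel₀ _ hm.ne'] using h

lemma mul_eq_mul_of_add_rpow_eq {p : ℝ} (hp : 1 < p) {l m : ℝ≥0} (hl : 0 < l) (hm : 0 < m)
    (hlm : l + m = 1) {x y : ℝ≥0} (h : l * (x / l) ^ p + m * (y / m) ^ p ≤ (x + y) ^ p) :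
    m * x = l * y := by
  by_contra hne
  have hxy : x / l ≠ y / m := by
    rw [Ne, div_eq_div_iff hl.ne' hm.ne']
    intro h'
    exact hne (by rw [mul_comm, h', mul_comm])
  have hs := (strictConvexOn_nnreal_rpow hp).2 (mem_univ (x / l)) (mem_univ (y / m)) hxy hl hm hlm
  simp only [smul_eq_mul, mul_div_cancel₀ _ hl.ne', mul_div_cancel₀ _ hm.ne'] at hs
  exact hs.not_ge h

lemma exists_coe_eq_of_ne_top {x : ℝ≥0∞} (h : x ≠ ∞) : ∃ a : ℝ≥0, (a : ℝ≥0∞) = x :=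
  ⟨x.toNNReal, ENNReal.coe_toNNReal h⟩

/-- The equality case of Minkowski's inequality: if `w ≤ u + v` and the norm of `w` is the sum of
the norms of `u` and `v`, then `w = u + v`, and `u` and `v` are proportional. -/
lemma ae_eq_add_of_norm_eq_add {p : ℝ} (hp : 1 < p) {u v w : OpenUnit → ℝ≥0}
    (hu : Measurable u) (hv : Measurable v) {a b : ℝ≥0} (ha : 0 < a)
    (hb : 0 < b) (hua : ∫⁻ t, (u t : ℝ≥0∞) ^ p = (a : ℝ≥0∞) ^ p)
    (hvb : ∫⁻ t, (v t : ℝ≥0∞) ^ p = (b : ℝ≥0∞) ^ p)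
    (hwab : ∫⁻ t, (w t : ℝ≥0∞) ^ p = ((a : ℝ≥0∞) + b) ^ p) (hle : ∀ t, w t ≤ u t + v t) :
    ∀ᵐ t, w t = u t + v t ∧ b * u t = a * v t := by
  have hp0 : 0 < p := by linarith
  have hc (x : ℝ≥0) : (x : ℝ≥0∞) ^ p = ((x ^ p : ℝ≥0) : ℝ≥0∞) :=
    (ENNReal.coe_rpow_of_nonneg x hp0.le).symm
  rw [← ENNReal.coe_add] at hwab
  simp only [hc] at hua hvb hwab
  have hab : 0 < a + b := by positivity
  set l := a / (a + b) with hl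
  set m := b / (a + b) with hm
  have hl0 : 0 < l := by positivity
  have hm0 : 0 < m := by positivity
  have hlm : l + m = 1 := by rw [hl, hm, ← add_div, div_self hab.ne']
  have hwE (t : OpenUnit) : w t ^ p ≤ l * (u t / l) ^ p + m * (v t / m) ^ p :=
    (NNReal.rpow_le_rpow (hle t) hp0.le).trans (add_rpow_le_weighted hp hl0 hm0 hlm _ _)
  have hscale {x : OpenUnit → ℝ≥0} (hx : Measurable x) {d k : ℝ≥0} (hd : 0 < d)
      (hk : k = d / (a + b)) (hxd : ∫⁻ t, ((x t ^ p : ℝ≥0) : ℝ≥0∞) = ((d ^ p : ℝ≥0) : ℝ≥0∞)) :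
      ∫⁻ t, ((k * (x t / k) ^ p : ℝ≥0) : ℝ≥0∞) = ((k * (a + b) ^ p : ℝ≥0) : ℝ≥0∞) := by
    have : ∀ t, ((k * (x t / k) ^ p : ℝ≥0) : ℝ≥0∞) =
        ((k / k ^ p : ℝ≥0) : ℝ≥0∞) * ((x t ^ p : ℝ≥0) : ℝ≥0∞) := by
      intro t
      rw [← ENNReal.coe_mul, NNReal.div_rpow]
      congr 1
      ring
    simp_rw [this]
    rw [lintegral_const_mul _ (by fun_prop), hxd, ← ENNReal.coe_mul]
    congr 1
    have hdk : a + b = d / k := by rw [hk]; field_simp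
    rw [hdk, NNReal.div_rpow]
    ring
  have hE : ∫⁻ t, ((l * (u t / l) ^ p + m * (v t / m) ^ p : ℝ≥0) : ℝ≥0∞) ≤
      ∫⁻ t, ((w t ^ p : ℝ≥0) : ℝ≥0∞) := by
    simp_rw [ENNReal.coe_add]
    rw [lintegral_add_left (by fun_prop), hscale hu ha hl hua, hscale hv hb hm hvb, hwab,
      ← ENNReal.coe_add, ← add_mul, hlm, one_mul]
  have hae := ae_eq_of_ae_le_of_lintegral_le
    (Eventually.of_forall fun t => ENNReal.coe_le_coe.2 (hwE t))
    (by rw [hwab]; exact ENNReal.coe_ne_top) (by fun_prop) hE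
  refine hae.mono fun t ht => ?_
  have ht' : w t ^ p = l * (u t / l) ^ p + m * (v t / m) ^ p := ENNReal.coe_inj.1 ht
  have h1 := add_rpow_le_weighted hp hl0 hm0 hlm (u t) (v t)
  have h2 : u t + v t ≤ w t := (NNReal.rpow_le_rpow_iff hp0).1 (h1.trans_eq ht'.symm)
  refine ⟨le_antisymm (hle t) h2, ?_⟩
  have h3 := mul_eq_mul_of_add_rpow_eq hp hl0 hm0 hlm
    (ht'.symm.le.trans (NNReal.rpow_le_rpow (hle t) hp0.le))
  rw [hl, hm] at h3
  field_simp at h3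
  exact h3

lemma add_eq_two_mul_of_nndist {x y z : ℝ≥0} (h1 : nndist x z = nndist x y + nndist y z)
    (h2 : nndist x y = nndist y z) : x + z = 2 * y := by
  have h1' : dist x z = dist x y + dist y z := by
    simp only [dist_nndist]; exact_mod_cast h1
  have h2' : dist x y = dist y z := by
    simp only [dist_nndist]; exact_mod_cast h2
  rw [NNReal.dist_eq, NNReal.dist_eq, NNReal.dist_eq] at h1'
  rw [NNReal.dist_eq, NNReal.dist_eq] at h2'
  have : (x : ℝ) + z = 2 * y := by
    rcases abs_cases ((x : ℝ) - z) with h | h <;> rcases abs_cases ((x : ℝ) - y) with h' | h' <;>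
      rcases abs_cases ((y : ℝ) - z) with h'' | h'' <;> linarith
  exact_mod_cast this

variable {p : ℝ}

/-- For `1 < p` metric midpoints are midpoints of quantile functions. -/
lemma ae_add_eq_of_isMetricMidpoint (hp : 1 < p) {f g h : QuantileFun p}
    (hm : IsMetricMidpoint f.law g.law h.law) : ∀ᵐ t, g t + h t = 2 * f t := by
  have hp0 : 0 < p := by linarith
  obtain ⟨h1, h2⟩ := hm
  by_cases h0 : wdist f.law g.law = 0
  · have e1 := (law_eq_law_iff hp.le _ _).1 (eq_of_wdist_eq_zero hp.le h0)
    have e2 := (law_eq_law_iff hp.le _ _).1 (eq_of_wdist_eq_zero hp.le (h1.symm.trans h0))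
    filter_upwards [e1, e2] with t ht1 ht2
    rw [← ht1, ← ht2, two_mul]
  obtain ⟨a, ha⟩ := exists_coe_eq_of_ne_top (wdist_ne_top hp.le f g)
  have ha0 : 0 < a := by
    rw [pos_iff_ne_zero]
    rintro rfl
    exact h0 (by simpa using ha.symm)
  have e (f g : QuantileFun p) : ∫⁻ t, ((nndist (f t) (g t) : ℝ≥0) : ℝ≥0∞) ^ p =
      wdist f.law g.law ^ p := by
    rw [wdist_law_rpow hp.le, cost]
    simp only [edist_nndist]
  have := ae_eq_add_of_norm_eq_add hp (u := fun t => nndist (g t) (f t))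
    (v := fun t => nndist (f t) (h t)) (w := fun t => nndist (g t) (h t)) (by fun_prop)
    (by fun_prop) ha0 ha0 (by rw [e, wdist_comm hp.le, ha])
    (by rw [e, ← h1, ha]) (by rw [e, h2, ha, two_mul]) (fun t => nndist_triangle _ _ _)
  refine this.mono fun t ht => add_eq_two_mul_of_nndist ht.1 ?_
  exact mul_left_cancel₀ ha0.ne' ht.2

/-! ### Two-point measures charging the origin -/

/-- The quantile function of the measure with mass `1 - τ` at `c` and the rest at the origin. -/
noncomputable def QuantileFun.step (hp : 1 ≤ p) (c : ℝ≥0) (τ : ℝ) : QuantileFun p :=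
  .ofBounded hp (fun t => if τ < t then c else 0) (by
    intro s t hst
    have hst' : (s : ℝ) ≤ t := hst
    dsimp only
    split_ifs with h1 h2
    · exact le_rfl
    · exact absurd (h1.trans_le hst') h2
    · exact zero_le
    · exact le_rfl) c (by
    intro t
    split_ifs
    · exact le_rfl
    · exact zero_le)

lemma step_of_lt (hp : 1 ≤ p) (c : ℝ≥0) {τ : ℝ} {t : OpenUnit} (h : τ < t) :
    QuantileFun.step hp c τ t = c := if_pos h

lemma step_of_le (hp : 1 ≤ p) (c : ℝ≥0) {τ : ℝ} {t : OpenUnit} (h : (t : ℝ) ≤ τ) :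
    QuantileFun.step hp c τ t = 0 := if_neg h.not_gt

lemma law_step_zero (hp : 1 ≤ p) (τ : ℝ) : (QuantileFun.step hp 0 τ).law = origin hp := by
  refine QuantileFun.law_congr (Eventually.of_forall fun t => ?_)
  rcases lt_or_ge τ t with h | h
  · rw [step_of_lt hp 0 h]; rfl
  · rw [step_of_le hp 0 h]; rfl

lemma measurableSet_lt_coe (τ : ℝ) : MeasurableSet {t : OpenUnit | τ < t} :=
  measurableSet_lt measurable_const measurable_subtype_coe

lemma wdist_step_step (hp : 1 ≤ p) (a b : ℝ≥0) (τ : ℝ) :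
    wdist (QuantileFun.step hp a τ).law (QuantileFun.step hp b τ).law =
      edist a b * volume {t : OpenUnit | τ < t} ^ (1 / p) := by
  have hp0 : 0 < p := by linarith
  rw [wdist_law hp, cost]
  have : ∀ t : OpenUnit, edist (QuantileFun.step hp a τ t) (QuantileFun.step hp b τ t) ^ p =
      {t : OpenUnit | τ < t}.indicator (fun _ => edist a b ^ p) t := by
    intro t
    rcases lt_or_ge τ t with h | h
    · rw [indicator_of_mem (s := {t : OpenUnit | τ < t}) h, step_of_lt hp a h, step_of_lt hp b h]
    · rw [indicator_of_notMem (s := {t : OpenUnit | τ < t}) (fun h' => h.not_gt h'),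
        step_of_le hp a h, step_of_le hp b h]
      simp [hp0]
  simp_rw [this]
  rw [lintegral_indicator_const (measurableSet_lt_coe τ),
    ENNReal.mul_rpow_of_nonneg _ _ (by positivity), ← ENNReal.rpow_mul,
    mul_one_div_cancel hp0.ne', ENNReal.rpow_one]

lemma edist_add_edist_zero_of_le {a b : ℝ≥0} (h : a ≤ b) :
    edist a b + edist a 0 = edist b 0 := by
  simp only [edist_nndist, NNReal.nndist_eq]
  norm_cast
  simp [tsub_eq_zero_of_le h, tsub_add_cancel_of_le h]

lemma isAligned_step_step (hp : 1 ≤ p) (a b : ℝ≥0) (τ : ℝ) :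
    IsAligned hp (QuantileFun.step hp a τ).law (QuantileFun.step hp b τ).law := by
  wlog h : a ≤ b generalizing a b
  · exact (this b a (le_of_not_ge h)).symm
  left
  rw [← law_step_zero hp τ, wdist_step_step, wdist_step_step, wdist_step_step, ← add_mul,
    edist_add_edist_zero_of_le h]

/-- If a two-point measure with atoms at `0` and `c` is a midpoint, the quantile functions `g`, `h`
of the endpoints satisfy `g + h = 0` or `g + h = 2 * c`. As both are monotone, they are constant on the
set where the latter holds. -/
lemma isExtremal_step (hp : 1 < p) (c : ℝ≥0) (τ : ℝ) :
    IsExtremal hp.le (QuantileFun.step hp.le c τ).law := by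
  intro a b hab
  obtain ⟨g, rfl⟩ := exists_law_eq hp.le a
  obtain ⟨h, rfl⟩ := exists_law_eq hp.le b
  have hae := ae_add_eq_of_isMetricMidpoint hp hab
  obtain ⟨d, hd⟩ : ∃ d, ∀ᵐ t, g t = QuantileFun.step hp.le d τ t := by
    by_cases hex : ∃ t₀ : OpenUnit, τ < t₀ ∧ g t₀ + h t₀ = 2 * c
    · obtain ⟨t₀, ht₀, hs₀⟩ := hex
      refine ⟨g t₀, hae.mono fun t ht => ?_⟩
      rcases lt_or_ge τ t with hτ | hτ
      · rw [step_of_lt _ _ hτ] at ht ⊢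
        rw [← hs₀] at ht
        rcases le_total t t₀ with hle | hle
        · exact ((add_eq_add_iff_eq_and_eq (g.monotone hle) (h.monotone hle)).1 ht).1
        · exact ((add_eq_add_iff_eq_and_eq (g.monotone hle) (h.monotone hle)).1 ht.symm).1.symm
      · rw [step_of_le _ _ hτ] at ht ⊢
        exact (add_eq_zero.1 (ht.trans (mul_zero _))).1
    · refine ⟨0, hae.mono fun t ht => ?_⟩
      rcases lt_or_ge τ t with hτ | hτ
      · rw [step_of_lt _ _ hτ] at ht
        exact absurd ⟨t, hτ, ht⟩ hex
      · rw [step_of_le _ _ hτ] at ht ⊢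
        exact (add_eq_zero.1 (ht.trans (mul_zero _))).1
  rw [QuantileFun.law_congr hd]
  exact isAligned_step_step hp.le d c τ

/-- `f` is the midpoint of `min f k` and `f + (f - k)₊`; if `min f k` and `f` are aligned, they
are proportional, so that `f` has no nonzero value below `k`, unless `f ≤ k`. -/
lemma ae_le_or_ae_of_isExtremal (hp : 1 < p) {f : QuantileFun p} (hf : IsExtremal hp.le f.law)
    (k : ℝ≥0) : (∀ᵐ t, f t ≤ k) ∨ ∀ᵐ t, f t = 0 ∨ k < f t := by
  have hp0 : 0 < p := by linarith
  let g : QuantileFun p := .ofLe hp.le f 1 (fun t => min (f t) k)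
    (fun s t h => min_le_min_right _ (f.monotone h)) fun t => by simp
  let h : QuantileFun p := .ofLe hp.le f 2 (fun t => f t + (f t - k))
    (fun s t h => add_le_add (f.monotone h) (tsub_le_tsub_right (f.monotone h) k))
    fun t => by rw [two_mul]; exact add_le_add_right tsub_le_self _
  have hg (t) : g t = min (f t) k := rfl
  have hh (t) : h t = f t + (f t - k) := rfl
  have hd1 (t) : edist (f t) (g t) = ((f t - k : ℝ≥0) : ℝ≥0∞) := by
    have : f t = g t + (f t - k) := by
      rw [hg]
      rcases le_total (f t) k with hx | hx
      · rw [min_eq_left hx, tsub_eq_zero_of_le hx, add_zero]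
      · rw [min_eq_right hx, add_tsub_cancel_of_le hx]
    rw [edist_comm]
    nth_rw 1 [this]
    rw [edist_add_tsub]
  have hd2 (t) : edist (f t) (h t) = ((f t - k : ℝ≥0) : ℝ≥0∞) := by rw [hh, edist_add_tsub]
  have hd3 (t) : edist (g t) (h t) = 2 * ((f t - k : ℝ≥0) : ℝ≥0∞) := by
    have : h t = g t + 2 * (f t - k) := by
      rw [hh, hg]
      rcases le_total (f t) k with hx | hx
      · rw [min_eq_left hx, tsub_eq_zero_of_le hx]; simp
      · rw [min_eq_right hx, two_mul, ← add_assoc, add_tsub_cancel_of_le hx]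
    rw [this, edist_add_tsub]
    push_cast
    rfl
  have hmid : IsMetricMidpoint f.law g.law h.law := by
    rw [isMetricMidpoint_law_iff hp.le]
    simp only [cost, hd1, hd2, hd3, true_and]
    rw [← lintegral_const_mul _ (by fun_prop)]
    refine lintegral_congr fun t => ?_
    rw [ENNReal.mul_rpow_of_nonneg _ _ hp0.le]
  by_cases hb : wdist g.law f.law = 0
  · left
    have := (law_eq_law_iff hp.le _ _).1 (eq_of_wdist_eq_zero hp.le hb)
    refine this.mono fun t ht => ?_
    rw [← ht]
    exact min_le_right _ _
  right
  by_cases ha : wdist g.law (origin hp.le) = 0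
  · have := (law_eq_law_iff hp.le _ _).1 (eq_of_wdist_eq_zero hp.le ha)
    refine this.mono fun t ht => ?_
    have ht' : min (f t) k = 0 := ht
    rcases min_choice (f t) k with hx | hx
    · left; rw [← hx, ht']
    · rcases eq_or_ne (f t) 0 with h0 | h0
      · exact Or.inl h0
      · right; rw [← hx, ht']; exact pos_iff_ne_zero.2 h0
  obtain ⟨b, hbb⟩ := exists_coe_eq_of_ne_top (wdist_ne_top hp.le g f)
  obtain ⟨a, haa⟩ := exists_coe_eq_of_ne_top
    (wdist_ne_top hp.le g (QuantileFun.const hp.le 0))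
  change _ = wdist g.law (origin hp.le) at haa
  have hb0 : 0 < b := by
    rw [pos_iff_ne_zero]; rintro rfl; exact hb (by simpa using hbb.symm)
  have ha0 : 0 < a := by
    rw [pos_iff_ne_zero]; rintro rfl; exact ha (by simpa using haa.symm)
  rcases hf _ _ hmid with hal | hal
  · have hdist (t) : ((nndist (g t) (f t) : ℝ≥0) : ℝ≥0∞) = ((f t - k : ℝ≥0) : ℝ≥0∞) := by
      rw [← edist_nndist, edist_comm, hd1]
    have hm := ae_eq_add_of_norm_eq_add hp (u := g) (v := fun t => nndist (g t) (f t)) (w := f)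
      g.measurable (by fun_prop) ha0 hb0
      (by rw [← wdist_origin_rpow hp.le, haa])
      (by rw [hbb, wdist_law_rpow hp.le, cost]; simp only [edist_nndist])
      (by rw [← wdist_origin_rpow hp.le, ← hal, haa, hbb, add_comm]) (fun t => by
        have := nndist_triangle (f t) (g t) 0
        rw [NNReal.nndist_zero_eq_val', NNReal.nndist_zero_eq_val', nndist_comm] at this
        rwa [add_comm])
    refine hm.mono fun t ht => ?_
    rcases le_or_gt (f t) k with hx | hx
    · left
      have h0 : nndist (g t) (f t) = 0 := by
        have := hdist t
        rw [tsub_eq_zero_of_le hx] at this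
        exact_mod_cast this
      have h1 := ht.2
      rw [h0, mul_zero, mul_eq_zero, hg, min_eq_left hx] at h1
      exact h1.resolve_left hb0.ne'
    · exact Or.inr hx
  · exfalso
    have hle : wdist g.law (origin hp.le) ≤ wdist f.law (origin hp.le) := by
      rw [← ENNReal.rpow_le_rpow_iff hp0, wdist_origin_rpow, wdist_origin_rpow]
      exact lintegral_mono fun t =>
        ENNReal.rpow_le_rpow (ENNReal.coe_le_coe.2 (min_le_left _ _)) hp0.le
    rw [← hal, ← hbb] at hle
    have hfin := wdist_ne_top hp.le f (QuantileFun.const hp.le 0)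
    have : (b : ℝ≥0∞) ≤ 0 := (ENNReal.add_le_add_iff_right hfin).1 (by rwa [zero_add])
    exact hb0.ne' (by simpa using this)

lemma volume_coe_eq (τ : ℝ) : volume {t : OpenUnit | (t : ℝ) = τ} = 0 := by
  have h := volume_coe_preimage (measurableSet_singleton τ)
  exact h.trans (measure_mono_null inter_subset_left (by simp))

/-- Two different nonzero values of `f` would contradict `ae_le_or_ae_of_isExtremal`, with the
smaller one as `k`. -/
lemma exists_step_of_isExtremal (hp : 1 < p) {m : WassersteinSpace ℝ≥0 p}
    (hm : IsExtremal hp.le m) :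
    ∃ (c : ℝ≥0) (τ : ℝ), 0 ≤ τ ∧ τ < 1 ∧ m = (QuantileFun.step hp.le c τ).law := by
  obtain ⟨f, rfl⟩ := exists_law_eq hp.le m
  by_cases hz : ∀ t, f t = 0
  · refine ⟨0, 0, le_rfl, one_pos, ?_⟩
    rw [law_step_zero]
    exact QuantileFun.law_congr (Eventually.of_forall hz)
  push Not at hz
  obtain ⟨t₁, ht₁⟩ := hz
  -- the support of `f` is an interval with left endpoint `τ`
  set N : Set ℝ := (↑) '' {t : OpenUnit | f t ≠ 0} with hN
  have hNbdd : BddBelow N := ⟨0, by rintro _ ⟨t, -, rfl⟩; exact t.2.1.le⟩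
  have hNne : N.Nonempty := ⟨_, t₁, ht₁, rfl⟩
  set τ := sInf N with hτ
  have hτ0 : 0 ≤ τ := le_csInf hNne (by rintro _ ⟨t, -, rfl⟩; exact t.2.1.le)
  have hτ1 : τ < 1 := (csInf_le hNbdd ⟨t₁, ht₁, rfl⟩).trans_lt t₁.2.2
  have hpos {s : OpenUnit} (hs : τ < s) : ∃ s' : OpenUnit, f s' ≠ 0 ∧ s' < s := by
    obtain ⟨_, ⟨s', hs', rfl⟩, hlt⟩ := exists_lt_of_csInf_lt hNne hs
    exact ⟨s', hs', hlt⟩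
  have hconst {s t : OpenUnit} (hs : τ < s) : f t ≤ f s := by
    by_contra! hlt
    obtain ⟨s', hs', hss'⟩ := hpos hs
    rcases ae_le_or_ae_of_isExtremal hp hm (f s) with h | h
    · refine (volume_Ioi_pos t).ne' (measure_mono_null (fun x hx => ?_) (ae_iff.1 h))
      exact not_le.2 (hlt.trans_le (f.monotone (le_of_lt hx)))
    · refine (volume_Ioc_pos hss').ne' (measure_mono_null (fun x hx => ?_) (ae_iff.1 h))
      simp only [mem_ofPred_eq, not_or, not_lt]
      exact ⟨((pos_iff_ne_zero.2 hs').trans_le (f.monotone hx.1.le)).ne', f.monotone hx.2⟩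
  let t₂ : OpenUnit := ⟨(τ + 1) / 2, by constructor <;> linarith⟩
  have ht₂ : τ < t₂ := by change τ < (τ + 1) / 2; linarith
  refine ⟨f t₂, τ, hτ0, hτ1, QuantileFun.law_congr ?_⟩
  have hne : ∀ᵐ t : OpenUnit, (t : ℝ) ≠ τ := by
    rw [ae_iff]
    simpa using volume_coe_eq τ
  refine hne.mono fun t ht => ?_
  rcases lt_or_gt_of_ne ht with h | h
  · rw [step_of_le _ _ h.le]
    by_contra h0
    exact (csInf_le hNbdd ⟨t, h0, rfl⟩).not_gt h
  · rw [step_of_lt _ _ h]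
    exact le_antisymm (hconst ht₂) (hconst h)

/-! ### Isometries fix the two-point measures -/

/-- The two-point measures of norm `r` charging the origin: mass `q ^ p` at `r / q`, the rest at
the origin, for `0 < q ≤ 1`. -/
noncomputable def normStep (hp : 1 ≤ p) (r q : ℝ≥0) : QuantileFun p :=
  .step hp (r / q) (1 - ((q ^ p : ℝ≥0) : ℝ))

lemma volume_lt_one_sub (hp : 1 ≤ p) {q : ℝ≥0} (hq : q ≤ 1) :
    volume {t : OpenUnit | 1 - ((q ^ p : ℝ≥0) : ℝ) < t} = (q : ℝ≥0∞) ^ p := by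
  have h1 : ((q ^ p : ℝ≥0) : ℝ) ≤ 1 := by
    exact_mod_cast NNReal.rpow_le_one hq (by linarith)
  rw [volume_lt_coe (by linarith) (by linarith [(q ^ p).2]), sub_sub_cancel,
    ENNReal.ofReal_coe_nnreal, ENNReal.coe_rpow_of_nonneg _ (by linarith)]

lemma wdist_step_origin (hp : 1 ≤ p) (c : ℝ≥0) {q : ℝ≥0} (hq : q ≤ 1) :
    wdist (QuantileFun.step hp c (1 - ((q ^ p : ℝ≥0) : ℝ))).law (origin hp) = (c * q : ℝ≥0) := by
  have hp0 : p ≠ 0 := by linarith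
  rw [← law_step_zero hp (1 - ((q ^ p : ℝ≥0) : ℝ)), wdist_step_step, volume_lt_one_sub hp hq,
    ← ENNReal.rpow_mul, mul_one_div_cancel hp0, ENNReal.rpow_one, edist_nndist,
    NNReal.nndist_zero_eq_val', ENNReal.coe_mul]

lemma wdist_normStep_origin (hp : 1 ≤ p) (r : ℝ≥0) {q : ℝ≥0} (hq0 : 0 < q) (hq : q ≤ 1) :
    wdist (normStep hp r q).law (origin hp) = r := by
  rw [normStep, wdist_step_origin hp _ hq, div_mul_cancel₀ _ hq0.ne']

/-- The distance of two normalized two-point measures depends only on the ratio of their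
parameters. -/
lemma cost_normStep (hp : 1 ≤ p) (r : ℝ≥0) {q q' : ℝ≥0} (hq0 : 0 < q) (hqq' : q ≤ q')
    (hq' : q' ≤ 1) :
    cost p (normStep hp r q) (normStep hp r q') + ((r * (q / q') : ℝ≥0) : ℝ≥0∞) ^ p =
      (r : ℝ≥0∞) ^ p + ((r - r * (q / q') : ℝ≥0) : ℝ≥0∞) ^ p := by
  have hp0 : 0 < p := by linarith
  have hq'0 : 0 < q' := hq0.trans_le hqq'
  set E : Set OpenUnit := {t | 1 - ((q ^ p : ℝ≥0) : ℝ) < t} with hE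
  set E' : Set OpenUnit := {t | 1 - ((q' ^ p : ℝ≥0) : ℝ) < t} with hE'
  have hEE' : E ⊆ E' := by
    intro t ht
    have : ((q ^ p : ℝ≥0) : ℝ) ≤ (q' ^ p : ℝ≥0) :=
      NNReal.coe_le_coe.2 (NNReal.rpow_le_rpow hqq' hp0.le)
    have ht' : 1 - ((q ^ p : ℝ≥0) : ℝ) < t := ht
    change 1 - ((q' ^ p : ℝ≥0) : ℝ) < t
    linarith
  have hEm : MeasurableSet E := measurableSet_lt_coe _
  have hEm' : MeasurableSet E' := measurableSet_lt_coe _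
  have hpt (t : OpenUnit) : edist (normStep hp r q t) (normStep hp r q' t) ^ p +
      E.indicator (fun _ => ((r / q' : ℝ≥0) : ℝ≥0∞) ^ p) t =
      E'.indicator (fun _ => ((r / q' : ℝ≥0) : ℝ≥0∞) ^ p) t +
      E.indicator (fun _ => ((r / q - r / q' : ℝ≥0) : ℝ≥0∞) ^ p) t := by
    by_cases h : t ∈ E
    · rw [indicator_of_mem h, indicator_of_mem h, indicator_of_mem (hEE' h), normStep, normStep,
        step_of_lt _ _ h, step_of_lt _ _ (hEE' h), add_comm, edist_nndist, NNReal.nndist_eq,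
        max_eq_left]
      rw [tsub_eq_zero_of_le (div_le_div_of_nonneg_left zero_le hq0 hqq')]
      exact zero_le
    · rw [indicator_of_notMem h, indicator_of_notMem h, add_zero, add_zero, normStep, normStep,
        step_of_le _ _ (not_lt.1 h)]
      by_cases h' : t ∈ E'
      · rw [indicator_of_mem h', step_of_lt _ _ h', edist_comm, edist_zero_rpow]
      · rw [indicator_of_notMem h', step_of_le _ _ (not_lt.1 h'), edist_self,
          ENNReal.zero_rpow_of_pos hp0]
  have hint := lintegral_congr (μ := volume) hpt
  rw [lintegral_add_right _ (measurable_const.indicator hEm),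
    lintegral_add_right _ (measurable_const.indicator hEm), lintegral_indicator_const hEm,
    lintegral_indicator_const hEm', lintegral_indicator_const hEm, hE, hE',
    volume_lt_one_sub hp (hqq'.trans hq'), volume_lt_one_sub hp hq',
    ← ENNReal.mul_rpow_of_nonneg _ _ hp0.le, ← ENNReal.mul_rpow_of_nonneg _ _ hp0.le,
    ← ENNReal.mul_rpow_of_nonneg _ _ hp0.le, ← ENNReal.coe_mul, ← ENNReal.coe_mul,
    ← ENNReal.coe_mul, div_mul_cancel₀ _ hq'0.ne', tsub_mul, div_mul_cancel₀ _ hq0.ne',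
    div_mul_eq_mul_div, mul_div_assoc] at hint
  exact hint

lemma div_eq_div_of_wdist_normStep_eq (hp : 1 ≤ p) {r q₁ q₂ q₃ q₄ : ℝ≥0} (hr : 0 < r)
    (h₁ : 0 < q₁) (h₁₂ : q₁ ≤ q₂) (h₂ : q₂ ≤ 1) (h₃ : 0 < q₃) (h₃₄ : q₃ ≤ q₄) (h₄ : q₄ ≤ 1)
    (h : wdist (normStep hp r q₁).law (normStep hp r q₂).law =
      wdist (normStep hp r q₃).law (normStep hp r q₄).law) : q₁ / q₂ = q₃ / q₄ := by
  wlog hlt : q₁ / q₂ < q₃ / q₄ generalizing q₁ q₂ q₃ q₄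
  · rcases eq_or_lt_of_le (not_lt.1 hlt) with h' | h'
    · exact h'.symm
    · exact (this h₃ h₃₄ h₄ h₁ h₁₂ h₂ h.symm h').symm
  exfalso
  have hp0 : 0 < p := by linarith
  have e1 := cost_normStep hp r h₁ h₁₂ h₂
  have e2 := cost_normStep hp r h₃ h₃₄ h₄
  rw [← (wdist_eq_iff hp _ _ _ _).1 h] at e2
  have hm : r * (q₁ / q₂) < r * (q₃ / q₄) := mul_lt_mul_of_pos_left hlt hr
  have hlt2 : ((r * (q₁ / q₂) : ℝ≥0) : ℝ≥0∞) ^ p < ((r * (q₃ / q₄) : ℝ≥0) : ℝ≥0∞) ^ p :=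
    ENNReal.rpow_lt_rpow (ENNReal.coe_lt_coe.2 hm) hp0
  have hle : (r : ℝ≥0∞) ^ p + ((r - r * (q₃ / q₄) : ℝ≥0) : ℝ≥0∞) ^ p ≤
      (r : ℝ≥0∞) ^ p + ((r - r * (q₁ / q₂) : ℝ≥0) : ℝ≥0∞) ^ p := by
    gcongr
  rw [← e1, ← e2] at hle
  exact hlt2.not_ge ((ENNReal.add_le_add_iff_left (cost_ne_top hp _ _)).1 hle)

lemma exists_normStep_of_isExtremal (hp : 1 < p) {m : WassersteinSpace ℝ≥0 p}
    (hm : IsExtremal hp.le m) {r : ℝ≥0} (hr : wdist m (origin hp.le) = r) :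
    ∃ q, 0 < q ∧ q ≤ 1 ∧ m = (normStep hp.le r q).law := by
  have hp0 : 0 < p := by linarith
  obtain ⟨c, τ, h0, h1, rfl⟩ := exists_step_of_isExtremal hp hm
  lift 1 - τ to ℝ≥0 using (by linarith) with u hu
  have hu0 : 0 < u := by rw [← NNReal.coe_pos, hu]; linarith
  have hu1 : u ≤ 1 := by rw [← NNReal.coe_le_coe, hu, NNReal.coe_one]; linarith
  have hq0 : 0 < u ^ (1 / p) := NNReal.rpow_pos hu0
  have hq1 : u ^ (1 / p) ≤ 1 := NNReal.rpow_le_one hu1 (by positivity)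
  have hqp : (u ^ (1 / p)) ^ p = u := by
    rw [← NNReal.rpow_mul, one_div_mul_cancel hp0.ne', NNReal.rpow_one]
  have hτ : τ = 1 - (((u ^ (1 / p)) ^ p : ℝ≥0) : ℝ) := by rw [hqp, hu]; ring
  refine ⟨u ^ (1 / p), hq0, hq1, ?_⟩
  rw [hτ, wdist_step_origin hp.le c hq1, ENNReal.coe_inj] at hr
  rw [normStep, ← hr, mul_div_cancel_right₀ _ hq0.ne', ← hτ]

section Isometry

variable {Φ : WassersteinSpace ℝ≥0 p → WassersteinSpace ℝ≥0 p}

lemma exists_map_normStep (hp : 1 < p) (hs : Function.Surjective Φ)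
    (hΦ : ∀ μ ν, wdist (Φ μ) (Φ ν) = wdist μ ν) (r : ℝ≥0) {q : ℝ≥0} (hq0 : 0 < q) (hq : q ≤ 1) :
    ∃ q', 0 < q' ∧ q' ≤ 1 ∧ Φ (normStep hp.le r q).law = (normStep hp.le r q').law :=
  exists_normStep_of_isExtremal hp ((isExtremal_map_iff hp.le hs hΦ _).2 (isExtremal_step hp _ _))
    (by rw [wdist_map_origin hp.le hs hΦ, ← wdist_normStep_origin hp.le r hq0 hq]; rfl)

/-- On the measures `normStep hp r q`, an isometry preserves the ratios of the parameters `q`, which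
range over `(0, 1]`. The only such bijection of `(0, 1]` is the identity. -/
lemma map_normStep (hp : 1 < p) (hs : Function.Surjective Φ)
    (hΦ : ∀ μ ν, wdist (Φ μ) (Φ ν) = wdist μ ν) {r : ℝ≥0} (hr : 0 < r) {q : ℝ≥0} (hq0 : 0 < q)
    (hq : q ≤ 1) : Φ (normStep hp.le r q).law = (normStep hp.le r q).law := by
  have hinj : Function.Injective Φ := fun a b h => eq_of_wdist_eq_zero hp.le <| by
    rw [← hΦ, h, wdist_self hp.le]
  -- `q₀` is the preimage of the endpoint `1`, and `q₁` is its image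
  obtain ⟨q₀, h00, h01, hq₀⟩ : ∃ q₀, 0 < q₀ ∧ q₀ ≤ 1 ∧
      Φ (normStep hp.le r q₀).law = (normStep hp.le r 1).law := by
    obtain ⟨m, hm⟩ := hs (normStep hp.le r 1).law
    obtain ⟨q₀, h0, h1, rfl⟩ := exists_normStep_of_isExtremal hp (m := m) (r := r)
      ((isExtremal_map_iff hp.le hs hΦ _).1 (hm ▸ isExtremal_step hp _ _))
      (by rw [← wdist_map_origin hp.le hs hΦ, hm, wdist_normStep_origin hp.le r one_pos le_rfl])
    exact ⟨q₀, h0, h1, hm⟩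
  obtain ⟨q₁, h10, h11, hq₁⟩ := exists_map_normStep hp hs hΦ r one_pos le_rfl
  have e1 : q₁ = q₀ := by
    have := hΦ (normStep hp.le r 1).law (normStep hp.le r q₀).law
    rw [hq₁, hq₀, wdist_comm hp.le (normStep hp.le r 1).law] at this
    simpa using div_eq_div_of_wdist_normStep_eq hp.le hr h10 h11 le_rfl h00 h01 le_rfl this
  -- the parameters `1` and `q₀ ^ 2` have the same ratio to `q₀`, so they have the same image
  have hsq : q₀ * q₀ ≤ q₀ := mul_le_of_le_one_left zero_le h01
  obtain ⟨q₂, h20, h21, hq₂⟩ := exists_map_normStep hp hs hΦ r (mul_pos h00 h00) (hsq.trans h01)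
  have e2 : q₂ = q₀ := by
    have := hΦ (normStep hp.le r (q₀ * q₀)).law (normStep hp.le r q₀).law
    rw [hq₂, hq₀] at this
    have := div_eq_div_of_wdist_normStep_eq hp.le hr h20 h21 le_rfl (mul_pos h00 h00) hsq h01 this
    rwa [div_one, mul_div_cancel_right₀ _ h00.ne'] at this
  have e3 : (normStep hp.le r (q₀ * q₀)).law = (normStep hp.le r 1).law :=
    hinj (by rw [hq₂, hq₁, e1, e2])
  have e4 : q₀ * q₀ = 1 := by
    have h := div_eq_div_of_wdist_normStep_eq hp.le hr (mul_pos h00 h00) (hsq.trans h01) le_rfl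
      one_pos le_rfl le_rfl (by rw [e3])
    simpa using h
  have e5 : q₀ = 1 := le_antisymm h01 (e4 ▸ hsq)
  rw [e5] at hq₀
  obtain ⟨q', h0, h1, hq'⟩ := exists_map_normStep hp hs hΦ r hq0 hq
  have := hΦ (normStep hp.le r q).law (normStep hp.le r 1).law
  rw [hq', hq₀] at this
  have := div_eq_div_of_wdist_normStep_eq hp.le hr h0 h1 le_rfl hq0 hq le_rfl this
  rw [div_one, div_one] at this
  rw [hq', this]

lemma map_step (hp : 1 < p) (hs : Function.Surjective Φ)
    (hΦ : ∀ μ ν, wdist (Φ μ) (Φ ν) = wdist μ ν) (c : ℝ≥0) (τ : ℝ) :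
    Φ (QuantileFun.step hp.le c τ).law = (QuantileFun.step hp.le c τ).law := by
  obtain ⟨r, hr⟩ := exists_coe_eq_of_ne_top
    (wdist_ne_top hp.le (QuantileFun.step hp.le c τ) (QuantileFun.const hp.le 0))
  obtain ⟨q, h0, h1, hq⟩ := exists_normStep_of_isExtremal hp (isExtremal_step hp c τ) hr.symm
  rcases eq_or_ne r 0 with rfl | hr0
  · have : (QuantileFun.step hp.le c τ).law = origin hp.le :=
      eq_of_wdist_eq_zero hp.le (hr.symm.trans ENNReal.coe_zero)
    rw [this, map_origin hp.le hs hΦ]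
  · rw [hq, map_normStep hp hs hΦ (pos_iff_ne_zero.2 hr0) h0 h1]

end Isometry

/-! ### Two-point measures separate points -/

/-- If `x < c < y`, then `|x - c| ^ p - x ^ p > |y - c| ^ p - y ^ p`. -/
lemma edist_rpow_add_rpow_lt (hp : 1 ≤ p) {x y c : ℝ≥0} (hx : x < c) (hy : c < y) :
    (x : ℝ≥0∞) ^ p + edist y c ^ p < edist x c ^ p + (y : ℝ≥0∞) ^ p := by
  have hp0 : 0 < p := by linarith
  have e : (y : ℝ≥0∞) = (c : ℝ≥0∞) + edist y c := by
    have h := edist_add_right_eq y c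
    rw [tsub_eq_zero_of_le hy.le] at h
    simpa [add_comm] using h.symm
  calc (x : ℝ≥0∞) ^ p + edist y c ^ p
      < (c : ℝ≥0∞) ^ p + edist y c ^ p :=
        ENNReal.add_lt_add_right (ENNReal.rpow_ne_top_of_nonneg hp0.le (edist_ne_top _ _))
          (ENNReal.rpow_lt_rpow (ENNReal.coe_lt_coe.2 hx) hp0)
    _ ≤ (y : ℝ≥0∞) ^ p := by
        rw [e]
        exact ENNReal.add_rpow_le_rpow_add _ _ hp
    _ ≤ _ := le_add_self

lemma edist_step_rpow (hp : 1 ≤ p) (x c : ℝ≥0) (τ : ℝ) (t : OpenUnit) :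
    edist x (QuantileFun.step hp c τ t) ^ p = if τ < t then edist x c ^ p else (x : ℝ≥0∞) ^ p := by
  split_ifs with h
  · rw [step_of_lt hp c h]
  · rw [step_of_le hp c (not_lt.1 h), edist_zero_rpow]

/-- If `f < c < g` on an interval, then the distances of `f` and `g` to the steps of height `c`
starting at the endpoints of the interval cannot agree. -/
lemma ae_le_of_wdist_step_eq (hp : 1 ≤ p) {f g : QuantileFun p}
    (h : ∀ c τ, wdist f.law (QuantileFun.step hp c τ).law =
      wdist g.law (QuantileFun.step hp c τ).law) : ∀ᵐ t, g t ≤ f t := by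
  obtain ⟨D, hDc, hD⟩ := TopologicalSpace.exists_countable_dense ℝ≥0
  suffices hnull : volume (⋃ c ∈ D, {t | f t < c ∧ c < g t}) = 0 by
    rw [ae_iff]
    refine measure_mono_null (fun t ht => ?_) hnull
    obtain ⟨c, hc, hlt⟩ := hD.exists_between (not_le.1 ht)
    exact mem_biUnion hc hlt
  refine (measure_biUnion_null_iff hDc).2 fun c _ => ?_
  have hsub : Set.Subsingleton {t | f t < c ∧ c < g t} := by
    intro s hs t ht
    by_contra hne
    wlog hst : s < t generalizing s t
    · exact this ht hs (Ne.symm hne) (lt_of_le_of_ne (not_lt.1 hst) (Ne.symm hne))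
    have hst' : (s : ℝ) < t := hst
    have hcs := (wdist_eq_iff hp _ _ _ _).1 (h c s)
    have hct := (wdist_eq_iff hp _ _ _ _).1 (h c t)
    -- the integrands agree outside `(s, t]`, where both steps have the same value
    let S : OpenUnit → ℝ≥0 := QuantileFun.step hp c s
    let T : OpenUnit → ℝ≥0 := QuantileFun.step hp c t
    have hSm : Measurable S := (QuantileFun.step hp c s).measurable
    have hTm : Measurable T := (QuantileFun.step hp c t).measurable
    have hlt {x : OpenUnit} (hx : x ∈ Ioc s t) :
        edist (f x) (T x) ^ p + edist (g x) (S x) ^ p <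
          edist (f x) (S x) ^ p + edist (g x) (T x) ^ p := by
      have h1 : (s : ℝ) < x := hx.1
      have h2 : ¬ (t : ℝ) < x := not_lt.2 hx.2
      simp only [S, T, edist_step_rpow, if_pos h1, if_neg h2]
      exact edist_rpow_add_rpow_lt hp ((f.monotone hx.2).trans_lt ht.1)
        (hs.2.trans_le (g.monotone hx.1.le))
    have hle (x : OpenUnit) : edist (f x) (T x) ^ p + edist (g x) (S x) ^ p ≤
        edist (f x) (S x) ^ p + edist (g x) (T x) ^ p := by
      by_cases hx : x ∈ Ioc s t
      · exact (hlt hx).le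
      · simp only [S, T, edist_step_rpow]
        by_cases h1 : (s : ℝ) < x
        · have h2 : (t : ℝ) < x := by
            by_contra h2
            exact hx ⟨h1, not_lt.1 h2⟩
          rw [if_pos h1, if_pos h2, if_pos h1, if_pos h2]
        · have h2 : ¬ (t : ℝ) < x := fun h2 => h1 (hst'.trans h2)
          rw [if_neg h1, if_neg h2, if_neg h1, if_neg h2]
    have hint : ∫⁻ x, (edist (f x) (S x) ^ p + edist (g x) (T x) ^ p) ≤
        ∫⁻ x, (edist (f x) (T x) ^ p + edist (g x) (S x) ^ p) := by
      rw [lintegral_add_left (by fun_prop), lintegral_add_left (by fun_prop)]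
      change cost p f (QuantileFun.step hp c s) + cost p g (QuantileFun.step hp c t) ≤
        cost p f (QuantileFun.step hp c t) + cost p g (QuantileFun.step hp c s)
      rw [hcs, hct, add_comm]
    have hfin : ∫⁻ x, (edist (f x) (T x) ^ p + edist (g x) (S x) ^ p) ≠ ∞ := by
      rw [lintegral_add_left (by fun_prop)]
      exact ENNReal.add_ne_top.2 ⟨cost_ne_top hp f (QuantileFun.step hp c t),
        cost_ne_top hp g (QuantileFun.step hp c s)⟩
    have hae := ae_eq_of_ae_le_of_lintegral_le (Eventually.of_forall hle) hfin (by fun_prop) hint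
    exact (volume_Ioc_pos hst).ne' (measure_mono_null (fun x hx => (hlt hx).ne) (ae_iff.1 hae))
  rcases hsub.eq_empty_or_singleton with he | ⟨t, ht⟩
  · rw [he, measure_empty]
  · rw [ht]
    refine measure_mono_null (fun x hx => ?_) (volume_coe_eq t)
    rw [mem_singleton_iff.1 hx]
    rfl

lemma eq_of_wdist_step_eq (hp : 1 ≤ p) {μ ν : WassersteinSpace ℝ≥0 p}
    (h : ∀ c τ, wdist μ (QuantileFun.step hp c τ).law =
      wdist ν (QuantileFun.step hp c τ).law) : μ = ν := by
  obtain ⟨f, rfl⟩ := exists_law_eq hp μ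
  obtain ⟨g, rfl⟩ := exists_law_eq hp ν
  refine QuantileFun.law_congr ?_
  filter_upwards [ae_le_of_wdist_step_eq hp h, ae_le_of_wdist_step_eq hp fun c τ => (h c τ).symm]
    with t h1 h2
  exact le_antisymm h2 h1

/-! ### Rigidity -/

theorem eq_id_of_isometry (hp : 1 ≤ p) {Φ : WassersteinSpace ℝ≥0 p → WassersteinSpace ℝ≥0 p}
    (hs : Function.Surjective Φ) (hΦ : ∀ μ ν, wdist (Φ μ) (Φ ν) = wdist μ ν) : Φ = id := by
  funext μ
  rcases hp.eq_or_lt with rfl | hp'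
  · exact eq_self_of_isometry_one hs hΦ μ
  · refine eq_of_wdist_step_eq hp fun c τ => ?_
    conv_lhs => rw [← map_step hp' hs hΦ c τ]
    exact hΦ _ _

end HalfLine

theorem theorem1p3 (p : ℝ) (hp : 1 ≤ p) :
    (∀ Φ : WassersteinSpace ℝ≥0 p → WassersteinSpace ℝ≥0 p,
      Function.Surjective Φ →
      (∀ μ ν, wassersteinDist p (Φ μ).1 (Φ ν).1 = wassersteinDist p μ.1 ν.1) →
      Φ = id) ∧
    IsIsometricallyRigid ℝ≥0 p := by
  have hid : ∀ Φ : WassersteinSpace ℝ≥0 p → WassersteinSpace ℝ≥0 p, Function.Surjective Φ →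
      (∀ μ ν, wassersteinDist p (Φ μ).1 (Φ ν).1 = wassersteinDist p μ.1 ν.1) → Φ = id :=
    fun Φ hs hΦ => HalfLine.eq_id_of_isometry hp hs hΦ
  refine ⟨hid, ?_, fun Ψ => ⟨1, ?_⟩⟩
  · -- an isometry of `[0, ∞)` can be read off from its action on Dirac measures
    rw [injective_iff_map_eq_one]
    intro φ hφ
    ext x : 1
    have h := congrArg (fun Ψ => ((Ψ : wassersteinIsom ℝ≥0 p).1
      (HalfLine.QuantileFun.const hp x).law).1) hφ
    change ((volume : Measure HalfLine.OpenUnit).map fun _ => x).map φ =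
      (volume : Measure HalfLine.OpenUnit).map fun _ => x at h
    rw [Measure.map_const, measure_univ, one_smul, Measure.map_dirac' φ.continuous.measurable] at h
    exact dirac_eq_dirac_iff.1 h
  · have h := hid Ψ.1 Ψ.1.surjective Ψ.2
    rw [map_one]
    exact Subtype.ext (Equiv.ext fun μ => (congrFun h μ).symm)
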